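/- Let $Y=\mu+\sigma\varepsilon\in\mathbb R^n$, with $\sigma>0$, $\varepsilon$ standard Gaussian, and $\mu_i=f(x_i)$ for deterministic design points $x_1,\dots,x_n\in[0,1)$ and a function $f$ on $[0,1)$. For $j\ge1$ let $\mathcal D_j=\{k2^{-j}:1\le k\le 2^j-1\}$, let $\mathcal M_{j,q}$ be the set of the $q$-element subsets of $\mathcal D_j$, and let $\mathcal M=\{\emptyset\}\cup\bigcup_{j\ge1}\bigcup_{1\le q\le(2^j-1)\wedge p}\mathcal M_{j,q}$. For $m\in\mathcal M$ let $S_m=\{(g(x_1),\dots,g(x_n)): g\in\mathcal F_m\}$, where $\mathcal F_m$ is the space of the continuous functions on $[0,1)$ that are affine on each of the intervals $[t_k,t_{k+1})$ determined by the knots in $m$ (with $t_0=0$ and last endpoint $1$). Let $D_m=\dim S_m$, $N_m=n-D_m$, let $\Pi_m$ be the orthogonal projector onto $S_m$ and $\hat\mu_m=\Pi_mY$. Put $L(j,q)=\log\binom{2^j-1}{q}+q+2\log j$ and $L_m=\inf\{L(j,q): j\ge1,\ 0\le q\le 2^j-1,\ m\in\mathcal M_{j,q}\}$. For independent $\chi^2$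 variables $X_D,X_N$ with $D$ and $N$ degrees of freedom let $\mathrm{Dkhi}[D,N,x]=\mathbb E[(X_D-xX_N/N)_+]/\mathbb E[X_D]$ for $x\ge0$, and for $0<r\le1$ let $\mathrm{EDkhi}[D,N,r]$ be the solution $x\ge0$ of $\mathrm{Dkhi}[D,N,x]=r$. For $K>1$ let $$\mathrm{pen}(m)=K\frac{N_m}{N_m-1}\,\mathrm{EDkhi}[D_m+1,N_m-1,e^{-L_m}],\qquad \mathrm{Crit}(m)=\|Y-\Pi_mY\|^2\Big(1+\frac{\mathrm{pen}(m)}{N_m}\Big).$$ For $q\ge1$ and $R>0$ let $\mathcal S^1(q,R)$ be the set of the continuous functions on $[0,1)$ of the form $\sum_{i=1}^{q+1}(\alpha_ix+\beta_i)\mathbf 1_{[a_{i-1},a_i)}(x)$ with $0=a_0<a_1<\dots<a_{q+1}=1$ and $\frac1q\sum_{i=1}^q|\alpha_{i+1}-\alpha_i|\le R$. **Corollary 2.** Let $K>1$, $\kappa\in(0,1)$ and $\kappa'>0$. There is a constant $C>0$ depending only on $K,\kappa,\kappa'$ such that the following holds for all $n\ge9$ and all $p\in\mathbb N$ with $p\le(\kappa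 n-2)\wedge(n-9)$, and all design points. A measurable function $\hat m=\hat m(Y)$ exists which, whatever $\mu\in\mathbb R^n$ and $\sigma>0$, minimizes $\mathrm{Crit}$ over $\mathcal M$ with probability $1$. Moreover, if $q\in\{1,\dots,p\}$, $\sigma>0$, $0<R\le\sigma e^{\kappa'n/q}$, $f\in\mathcal S^1(q,R)$ and $\mu_i=f(x_i)$ for all $i$, then every measurable $\hat m=\hat m(Y)\in\mathcal M$ that minimizes $\mathrm{Crit}$ over $\mathcal M$ with probability $1$ satisfies $$\mathbb E\big[\|\mu-\hat\mu_{\hat m}\|^2\big]\le C\,q\,\sigma^2\Big[1+\log\Big(1\vee\frac{nR^2}{q\sigma^2}\Big)\Big].$$ -/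

import Mathlib

open MeasureTheory ProbabilityTheory

noncomputable section

namespace ChangePoint

/-- `ℝⁿ` with its Euclidean norm and inner product. -/
abbrev Vec (n : ℕ) : Type := EuclideanSpace ℝ (Fin n)

/-- The interval `[0, 1)`, on which regression functions are defined. -/
abbrev UnitIco : Type := Set.Ico (0 : ℝ) 1

/-! ### The Gaussian regression model -/

/-- The law of `Y = μ + σ ε`, where `ε` is a standard Gaussian vector of `ℝⁿ`. -/
def obsLaw {n : ℕ} (μ : Vec n) (σ : ℝ) : Measure (Vec n) :=
  (stdGaussian (Vec n)).map (fun e => μ + σ • e)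

/-- The linear map `g ↦ (g (x₁), …, g (xₙ))`, for a design `x`. -/
def evalMap {n : ℕ} (x : Fin n → UnitIco) : (UnitIco → ℝ) →ₗ[ℝ] Vec n :=
  (WithLp.linearEquiv 2 ℝ (Fin n → ℝ)).symm.toLinearMap ∘ₗ LinearMap.funLeft ℝ ℝ x

/-! ### The collection of models -/

/-- The dyadic grid `{k 2⁻ʲ : k = 1, …, 2ʲ - 1}`. -/
def dyadicGrid (j : ℕ) : Finset ℝ :=
  (Finset.Icc 1 (2 ^ j - 1)).image (fun k : ℕ => (k : ℝ) / 2 ^ j)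

/-- The sets of `q` knots taken from the dyadic grid of level `j`. -/
def knotSets (j q : ℕ) : Set (Finset ℝ) :=
  {m | m ⊆ dyadicGrid j ∧ m.card = q}

/-- The index set of the models: all nonempty sets of at most `p` knots taken from one of the
dyadic grids, together with the empty set of knots. -/
def models (p : ℕ) : Set (Finset ℝ) :=
  (⋃ j ∈ Set.Ici 1, ⋃ q ∈ Set.Icc 1 (min (2 ^ j - 1) p), knotSets j q) ∪ {∅}

/-- The rank of the piece that contains `t`: if `t₁ < ⋯ < t_q` are the elements of `m`, `t₀ = 0`
and `t_{q+1} = 1`, then `pieceIdx m t = k` means that `t ∈ [t_k, t_{k+1})`. -/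
def pieceIdx (m : Finset ℝ) (t : ℝ) : ℕ := (m.filter (fun s => s ≤ t)).card

/-- The splines of degree `1` with knots in `m`: the continuous functions on `[0, 1)` that agree
with an affine function `α_k t + β_k` on each piece `[t_k, t_{k+1})`. -/
def splines (m : Finset ℝ) : Submodule ℝ (UnitIco → ℝ) where
  carrier := {g | Continuous g ∧ ∃ α β : ℕ → ℝ,
    ∀ t : UnitIco, g t = α (pieceIdx m t) * t + β (pieceIdx m t)}
  zero_mem' := ⟨continuous_zero, 0, 0, fun t => by simp⟩
  add_mem' := by
    rintro g h ⟨hg, α, β, hαβ⟩ ⟨hh, α', β', hαβ'⟩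
    refine ⟨hg.add hh, α + α', β + β', fun t => ?_⟩
    simp only [Pi.add_apply, hαβ t, hαβ' t]
    ring
  smul_mem' := by
    rintro c g ⟨hg, α, β, hαβ⟩
    refine ⟨hg.const_smul c, c • α, c • β, fun t => ?_⟩
    simp only [Pi.smul_apply, smul_eq_mul, hαβ t]
    ring

/-- The model `S_m ⊆ ℝⁿ`: the values of the splines at the design points. -/
def model {n : ℕ} (x : Fin n → UnitIco) (m : Finset ℝ) : Submodule ℝ (Vec n) :=
  (splines m).map (evalMap x)

/-- `D_m`, the dimension of `S_m`. -/
def dimModel {n : ℕ} (x : Fin n → UnitIco) (m : Finset ℝ) : ℕ :=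
  Module.finrank ℝ (model x m)

/-- `N_m = n - D_m`. -/
def codimModel {n : ℕ} (x : Fin n → UnitIco) (m : Finset ℝ) : ℕ :=
  n - dimModel x m

/-- The least-squares estimator on `S_m`: the orthogonal projection of `y` onto `S_m`. -/
def lsEstimator {n : ℕ} (x : Fin n → UnitIco) (m : Finset ℝ) (y : Vec n) : Vec n :=
  (model x m).starProjection y

/-! ### The penalty -/

/-- The `χ²` law with `d` degrees of freedom. -/
def chiSq (d : ℕ) : Measure ℝ :=
  (stdGaussian (Vec d)).map (fun v => ‖v‖ ^ 2)

/-- `Dkhi[D, N, x] = 𝔼[(X_D - x X_N / N)₊] / 𝔼[X_D]`, where `X_D`, `X_N` are independent `χ²`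
variables with `D` and `N` degrees of freedom. -/
def dkhi (D N : ℕ) (x : ℝ) : ℝ :=
  (∫ u, u ∂(chiSq D))⁻¹ *
    ∫ z : ℝ × ℝ, max (z.1 - x * (z.2 / N)) 0 ∂((chiSq D).prod (chiSq N))

/-- `EDkhi[D, N, r]`, for `0 < r ≤ 1`: the solution `x ≥ 0` of the equation `Dkhi[D, N, x] = r`
(it is unique, so that the infimum is that of a one-point set). -/
def eDkhi (D N : ℕ) (r : ℝ) : ℝ :=
  sInf {x : ℝ | 0 ≤ x ∧ dkhi D N x = r}

/-- The weight `L(j, q)`. -/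
def levelWeight (j q : ℕ) : ℝ :=
  Real.log ((2 ^ j - 1).choose q) + q + 2 * Real.log j

/-- The weight `L_m`, the infimum of the `L(j, q)` over the pairs `(j, q)` for which `m` is a set
of `q` knots of the dyadic grid of level `j ≥ 1`. -/
def weight (m : Finset ℝ) : ℝ :=
  sInf {l : ℝ | ∃ j q : ℕ, 1 ≤ j ∧ q ≤ 2 ^ j - 1 ∧ m ∈ knotSets j q ∧ l = levelWeight j q}

/-- The penalty `pen(m) = K (N_m / (N_m - 1)) EDkhi[D_m + 1, N_m - 1, exp (-L_m)]`. -/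
def penalty {n : ℕ} (K : ℝ) (x : Fin n → UnitIco) (m : Finset ℝ) : ℝ :=
  K * ((codimModel x m : ℝ) / ((codimModel x m : ℝ) - 1)) *
    eDkhi (dimModel x m + 1) (codimModel x m - 1) (Real.exp (-weight m))

/-- The penalized criterion `‖y - Π_m y‖² (1 + pen(m) / N_m)`. -/
def crit {n : ℕ} (K : ℝ) (x : Fin n → UnitIco) (m : Finset ℝ) (y : Vec n) : ℝ :=
  ‖y - lsEstimator x m y‖ ^ 2 * (1 + penalty K x m / (codimModel x m : ℝ))

/-- A data-driven choice of a model is measurable (the countable set of the models carries the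
discrete `σ`-algebra). -/
def MeasurableSelection {n p : ℕ} (sel : Vec n → models p) : Prop :=
  ∀ m : models p, MeasurableSet (sel ⁻¹' {m})

/-- With probability `1`, the selected model minimizes the criterion over all models, when `Y` has
mean `μ` and noise level `σ`. -/
def MinimizesCrit {n p : ℕ} (K : ℝ) (x : Fin n → UnitIco) (μ : Vec n) (σ : ℝ)
    (sel : Vec n → models p) : Prop :=
  ∀ᵐ y ∂(obsLaw μ σ), ∀ m ∈ models p, crit K x (sel y) y ≤ crit K x m y

/-! ### The class of regression functions -/

/-- The class `𝒮¹(q, R)`: the continuous functions on `[0, 1)` that are affine on each of the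
`q + 1` pieces `[a_i, a_{i+1})`, `0 = a_0 < ⋯ < a_{q+1} = 1`, with slopes `α_0, …, α_q` such that
the mean of the `|α_{i+1} - α_i|` is at most `R`. -/
def contPiecewiseLinear (q : ℕ) (R : ℝ) : Set (UnitIco → ℝ) :=
  {f | Continuous f ∧ ∃ (a : Fin (q + 2) → ℝ) (α β : Fin (q + 1) → ℝ),
    StrictMono a ∧ a 0 = 0 ∧ a (Fin.last (q + 1)) = 1 ∧
    (∀ (i : Fin (q + 1)) (t : UnitIco),
      (t : ℝ) ∈ Set.Ico (a i.castSucc) (a i.succ) → f t = α i * t + β i) ∧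
    (1 / (q : ℝ)) * ∑ i : Fin q, |α i.succ - α i.castSucc| ≤ R}

end ChangePoint

end

open scoped ENNReal

namespace ChangePoint

/-! ### The `χ²` laws -/

/-! Put each model S_m in a space V_m of dimension D_m + 1 that also contains μ. Since the
estimation error lies in V_m, weighting the cross term by K and 1/K bounds (1 - 1/K) times the loss
plus σ²‖ε‖² by Crit(m) plus Kσ² times an excess: the positive part of ‖Π_V ε‖² - a_m‖ε - Π_V ε‖²,
where a_m = EDkhi/(N_m - 1) (`loss_le_penalized_residual`). The two norms are independent χ²
variables, and the penalty is tuned so that the mean excess is exactly (D_m + 1) exp(-L_m)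
(`lintegral_excess`). These means have a bounded sum (`exists_tsum_exp_neg_weight_le`), so the
excess of the selected model costs a constant multiple of σ², and minimality of Crit gives
`oracle_inequality`.

The collection is infinite, so the criterion needs a reason to have a minimizer: the same
summability and Borel–Cantelli show that almost surely only finitely many models lie below any level
(`ae_finite_crit_le`).

It remains to exhibit one good model. A function of the class is affine plus q hinges; rounding its
breakpoints to the grid of level j costs qR/2^j in sup norm (`exists_dyadic_spline_approx`). With
2^j of order q√(1 ∨ nR²/(qσ²)), the squared bias is at most qσ² and the weight has the order of the
target bound (`exists_level`). A Chernoff bound on EDkhi (`dkhi_eDkhiBound_le`) makes the penalty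
linear in weight and dimension as long as these are of order N_m, which the upper bound on R
ensures. -/

lemma measurable_normSq {n : ℕ} : Measurable (fun v : Vec n => ‖v‖ ^ 2) := by fun_prop

instance isProbabilityMeasure_chiSq (d : ℕ) : IsProbabilityMeasure (chiSq d) :=
  Measure.isProbabilityMeasure_map measurable_normSq.aemeasurable

lemma chiSq_eq_map_pi (d : ℕ) :
    chiSq d = (Measure.pi fun _ : Fin d => gaussianReal 0 1).map (fun x => ∑ i, x i ^ 2) := by
  rw [chiSq, ← map_pi_eq_stdGaussian, Measure.map_map measurable_normSq (by fun_prop)]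
  congr 1
  ext x
  simp [EuclideanSpace.real_norm_sq_eq]

lemma measurable_sumSq (d : ℕ) : Measurable (fun x : Fin d → ℝ => ∑ i, x i ^ 2) := by fun_prop

lemma integrable_sq_gaussianReal : Integrable (fun t : ℝ => t ^ 2) (gaussianReal 0 1) :=
  (memLp_id_gaussianReal 2).integrable_sq

lemma integral_sq_gaussianReal : ∫ t : ℝ, t ^ 2 ∂(gaussianReal 0 1) = 1 := by
  have h := variance_id_gaussianReal (μ := 0) (v := 1)
  rw [variance_eq_integral (by fun_prop)] at h
  simpa using h

lemma integrable_id_chiSq (d : ℕ) : Integrable (fun u : ℝ => u) (chiSq d) := by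
  rw [chiSq_eq_map_pi, integrable_map_measure (by fun_prop) (measurable_sumSq d).aemeasurable]
  refine integrable_finsetSum _ fun i _ => ?_
  exact (measurePreserving_eval (fun _ : Fin d => gaussianReal 0 1) i).integrable_comp_of_integrable
    integrable_sq_gaussianReal

lemma integral_id_chiSq (d : ℕ) : ∫ u, u ∂(chiSq d) = d := by
  rw [chiSq_eq_map_pi, integral_map (measurable_sumSq d).aemeasurable (by fun_prop),
    integral_finsetSum]
  · have h (i : Fin d) : ∫ x : Fin d → ℝ, x i ^ 2 ∂(Measure.pi fun _ => gaussianReal 0 1) = 1 := by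
      rw [integral_comp_eval (μ := fun _ : Fin d => gaussianReal 0 1) (f := fun t : ℝ => t ^ 2)
        (by fun_prop), integral_sq_gaussianReal]
    simp [h]
  · intro i _
    exact (measurePreserving_eval
      (fun _ : Fin d => gaussianReal 0 1) i).integrable_comp_of_integrable
      integrable_sq_gaussianReal

lemma ae_nonneg_chiSq (d : ℕ) : ∀ᵐ u ∂(chiSq d), 0 ≤ u := by
  rw [chiSq, ae_map_iff measurable_normSq.aemeasurable measurableSet_Ici]
  exact Filter.Eventually.of_forall fun v => sq_nonneg _

lemma integral_exp_sq_gaussianReal {l : ℝ} (hl : l < 1 / 2) :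
    ∫ t : ℝ, Real.exp (l * t ^ 2) ∂(gaussianReal 0 1) = (√(1 - 2 * l))⁻¹ := by
  rw [integral_gaussianReal_eq_integral_smul one_ne_zero]
  have h : ∀ t : ℝ, gaussianPDFReal 0 1 t • Real.exp (l * t ^ 2) =
      (√(2 * Real.pi))⁻¹ * Real.exp (-(1 / 2 - l) * t ^ 2) := by
    intro t
    rw [gaussianPDFReal, smul_eq_mul, mul_assoc, ← Real.exp_add, NNReal.coe_one, mul_one, mul_one]
    congr 2
    ring
  simp_rw [h]
  rw [integral_const_mul, integral_gaussian, ← Real.sqrt_inv, ← Real.sqrt_inv,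
    ← Real.sqrt_mul (by positivity)]
  congr 1
  have h1 : (1 / 2 - l) ≠ 0 := by linarith
  have h2 : (1 - 2 * l) ≠ 0 := by linarith
  have := Real.pi_ne_zero
  field_simp

lemma integral_exp_chiSq (d : ℕ) {l : ℝ} (hl : l < 1 / 2) :
    ∫ u, Real.exp (l * u) ∂(chiSq d) = (√(1 - 2 * l))⁻¹ ^ d := by
  rw [chiSq_eq_map_pi, integral_map (measurable_sumSq d).aemeasurable (by fun_prop)]
  simp_rw [Finset.mul_sum, Real.exp_sum]
  rw [integral_fintype_prod_eq_prod (ι := Fin d) (μ := fun _ => gaussianReal 0 1)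
    (f := fun _ t => Real.exp (l * t ^ 2))]
  simp only [integral_exp_sq_gaussianReal hl]
  simp

lemma integrable_exp_chiSq (d : ℕ) {l : ℝ} (hl : l < 1 / 2) :
    Integrable (fun u : ℝ => Real.exp (l * u)) (chiSq d) := by
  -- The integral of a non-integrable function is 0 by convention, so a nonzero value proves
  -- integrability.
  refine .of_integral_ne_zero ?_
  have : 0 < 1 - 2 * l := by linarith
  rw [integral_exp_chiSq d hl]
  positivity

/-! ### Orthogonal projections of a standard Gaussian vector -/

section Projection

variable {E : Type*} [NormedAddCommGroup E] [InnerProductSpace ℝ E] [FiniteDimensional ℝ E]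
  [MeasurableSpace E] [BorelSpace E]

lemma map_normSq_stdGaussian {d : ℕ} (h : Module.finrank ℝ E = d) :
    (stdGaussian E).map (fun v => ‖v‖ ^ 2) = chiSq d := by
  subst h
  rw [chiSq, ← stdGaussian_map (stdOrthonormalBasis ℝ E).repr,
    Measure.map_map measurable_normSq (LinearIsometryEquiv.continuous _).measurable]
  congr 1
  ext v
  simp

/-- Independence is read off characteristic functions: by Pythagoras, exp(-‖t‖²/2) factors over V
and its complement. -/
lemma map_orthogonalProjections_stdGaussian (V : Submodule ℝ E) :
    (stdGaussian E).map (fun e => (V.orthogonalProjectionOnto e, Vᗮ.orthogonalProjectionOnto e)) =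
      (stdGaussian V).prod (stdGaussian Vᗮ) := by
  have : IsProbabilityMeasure ((stdGaussian E).map
      (fun e => (V.orthogonalProjectionOnto e, Vᗮ.orthogonalProjectionOnto e))) :=
    Measure.isProbabilityMeasure_map (by fun_prop)
  rw [← charFun_eq_prod_iff]
  intro t
  rw [Measure.map_map (by fun_prop) (by fun_prop)]
  have h := stdGaussian_map V.orthogonalDecomposition
  have h2 : (WithLp.toLp 2 ∘ fun e => (V.orthogonalProjectionOnto e,
      Vᗮ.orthogonalProjectionOnto e)) = V.orthogonalDecomposition := by
    ext1 e
    simp [Submodule.orthogonalDecomposition_apply]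
  rw [h2, h, charFun_stdGaussian, charFun_stdGaussian, charFun_stdGaussian, ← Complex.exp_add]
  congr 1
  have := WithLp.prod_norm_sq_eq_of_L2 t
  have h3 : ((‖t‖ : ℂ)) ^ 2 = (‖t.fst‖ : ℂ) ^ 2 + (‖t.snd‖ : ℂ) ^ 2 := by exact_mod_cast this
  rw [h3]
  change _ = -(‖t.fst‖ : ℂ) ^ 2 / 2 + -(‖t.snd‖ : ℂ) ^ 2 / 2
  ring

end Projection

/-- The squared norms of the projections of a standard Gaussian vector on a `d`-dimensional
subspace and on its orthogonal complement are independent `χ²` variables. -/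
lemma map_normSq_projections {n d : ℕ} (V : Submodule ℝ (Vec n)) (h : Module.finrank ℝ V = d) :
    (stdGaussian (Vec n)).map
      (fun e => (‖V.starProjection e‖ ^ 2, ‖e - V.starProjection e‖ ^ 2)) =
      (chiSq d).prod (chiSq (n - d)) := by
  have h' : Module.finrank ℝ Vᗮ = n - d := by
    have := V.finrank_add_finrank_orthogonal
    simp only [finrank_euclideanSpace_fin] at this
    omega
  rw [← map_normSq_stdGaussian h, ← map_normSq_stdGaussian h',
    Measure.map_prod_map _ _ (by fun_prop) (by fun_prop),
    ← map_orthogonalProjections_stdGaussian, Measure.map_map (by fun_prop) (by fun_prop)]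
  congr 1
  ext e
  · simp
  · simp [← Submodule.starProjection_orthogonal_val]

/-! ### The functions `Dkhi` and `EDkhi` -/

lemma ae_nonneg_chiSq_prod (D N : ℕ) :
    ∀ᵐ z ∂((chiSq D).prod (chiSq N)), 0 ≤ z.1 ∧ 0 ≤ z.2 :=
  (Measure.quasiMeasurePreserving_fst.ae (ae_nonneg_chiSq D)).and
    (Measure.quasiMeasurePreserving_snd.ae (ae_nonneg_chiSq N))

lemma ae_norm_dkhi_integrand_le (D N : ℕ) {x : ℝ} (hx : 0 ≤ x) :
    ∀ᵐ z ∂((chiSq D).prod (chiSq N)), ‖max (z.1 - x * (z.2 / N)) 0‖ ≤ z.1 := by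
  filter_upwards [ae_nonneg_chiSq_prod D N] with z hz
  rw [Real.norm_of_nonneg (le_max_right _ _)]
  refine max_le ?_ hz.1
  have : 0 ≤ x * (z.2 / N) := mul_nonneg hx (div_nonneg hz.2 N.cast_nonneg)
  linarith

lemma integrable_fst_chiSq_prod (D N : ℕ) :
    Integrable (fun z : ℝ × ℝ => z.1) ((chiSq D).prod (chiSq N)) :=
  (integrable_id_chiSq D).comp_fst (chiSq N)

lemma integrable_dkhi_integrand (D N : ℕ) {x : ℝ} (hx : 0 ≤ x) :
    Integrable (fun z : ℝ × ℝ => max (z.1 - x * (z.2 / N)) 0) ((chiSq D).prod (chiSq N)) :=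
  (integrable_fst_chiSq_prod D N).mono' (by fun_prop) (ae_norm_dkhi_integrand_le D N hx)

lemma continuousOn_dkhi (D N : ℕ) : ContinuousOn (dkhi D N) (Set.Ici 0) := by
  refine ContinuousOn.mul continuousOn_const ?_
  exact continuousOn_of_dominated (bound := fun z : ℝ × ℝ => z.1) (fun x _ => by fun_prop)
    (fun x hx => ae_norm_dkhi_integrand_le D N hx) (integrable_fst_chiSq_prod D N)
    (Filter.Eventually.of_forall fun z => by fun_prop)

lemma dkhi_zero {D : ℕ} (N : ℕ) (hD : 1 ≤ D) : dkhi D N 0 = 1 := by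
  have h : ∫ z : ℝ × ℝ, max (z.1 - 0 * (z.2 / N)) 0 ∂((chiSq D).prod (chiSq N)) = D := by
    rw [integral_congr_ae (g := fun z : ℝ × ℝ => z.1), integral_fun_fst (fun u : ℝ => u)]
    · simp [integral_id_chiSq]
    · filter_upwards [ae_nonneg_chiSq_prod D N] with z hz
      simp [hz.1]
  have : (D : ℝ) ≠ 0 := by positivity
  rw [dkhi, h, integral_id_chiSq, inv_mul_cancel₀ this]

/-- An upper bound of `EDkhi[D, N, exp (-L)]`. -/
noncomputable def eDkhiBound (D N : ℕ) (L : ℝ) : ℝ := 2 * N * (Real.exp (2 * (L + 2 * D) / N) - 1)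

lemma eDkhiBound_nonneg (D N : ℕ) {L : ℝ} (hL : 0 ≤ L) : 0 ≤ eDkhiBound D N L := by
  have : 1 ≤ Real.exp (2 * (L + 2 * D) / N) := Real.one_le_exp (by positivity)
  exact mul_nonneg (by positivity) (by linarith)

/-- Chernoff: z₊ ≤ 4 exp(z/4 - 1), after which the two χ² Laplace transforms separate. The bound is
chosen so that the second one equals exp(-(L + 2D)); the surplus 2D absorbs the first, √2^D ≤
exp(D/2), and the constant 4/e ≤ e. -/
lemma dkhi_eDkhiBound_le {D N : ℕ} (hD : 1 ≤ D) (hN : 1 ≤ N) {L : ℝ} (hL : 0 ≤ L) :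
    dkhi D N (eDkhiBound D N L) ≤ Real.exp (-L) := by
  set x := eDkhiBound D N L with hxdef
  have hx : 0 ≤ x := eDkhiBound_nonneg D N hL
  have hN0 : (0 : ℝ) < N := by exact_mod_cast hN
  have hD1 : (1 : ℝ) ≤ D := by exact_mod_cast hD
  have hl : -(x / (4 * N)) < 1 / 2 := by
    have : 0 ≤ x / (4 * N) := by positivity
    linarith
  have hbound : ∫ z : ℝ × ℝ, max (z.1 - x * (z.2 / N)) 0 ∂((chiSq D).prod (chiSq N)) ≤
      ∫ z : ℝ × ℝ, 4 * Real.exp (-1) *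
        (Real.exp (1 / 4 * z.1) * Real.exp (-(x / (4 * N)) * z.2)) ∂((chiSq D).prod (chiSq N)) := by
    refine integral_mono (integrable_dkhi_integrand D N hx) ?_ fun z => ?_
    · exact ((integrable_exp_chiSq D (by norm_num)).mul_prod
        (integrable_exp_chiSq N hl)).const_mul _
    · simp only
      rw [← Real.exp_add, mul_assoc, ← Real.exp_add]
      refine max_le ?_ (by positivity)
      have := Real.add_one_le_exp (-1 + (1 / 4 * z.1 + -(x / (4 * N)) * z.2))
      have h4 : x * (z.2 / N) = 4 * (x / (4 * N) * z.2) := by field_simp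
      linarith
  rw [integral_const_mul, integral_prod_mul (fun u => Real.exp (1 / 4 * u))
    (fun u => Real.exp (-(x / (4 * N)) * u)), integral_exp_chiSq D (by norm_num),
    integral_exp_chiSq N hl] at hbound
  have h1 : (√(1 - 2 * (1 / 4) : ℝ))⁻¹ ^ D ≤ Real.exp (D / 2) := by
    have : (√(1 - 2 * (1 / 4) : ℝ))⁻¹ ≤ Real.exp (1 / 2) := by
      rw [← Real.sqrt_inv, Real.sqrt_le_left (by positivity), ← Real.exp_nat_mul]
      have := Real.add_one_le_exp (1 : ℝ)
      norm_num at this ⊢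
      linarith
    calc _ ≤ Real.exp (1 / 2) ^ D := by gcongr
      _ = _ := by rw [← Real.exp_nat_mul]; congr 1; ring
  have h2 : (√(1 - 2 * (-(x / (4 * N))) : ℝ))⁻¹ ^ N = Real.exp (-(L + 2 * D)) := by
    have : 1 - 2 * (-(x / (4 * N))) = Real.exp (2 * (L + 2 * D) / N) := by
      rw [hxdef, eDkhiBound]
      field_simp
      ring
    rw [this, ← Real.exp_half, ← Real.exp_neg, ← Real.exp_nat_mul]
    congr 1
    field_simp
  have h4 : (4 : ℝ) ≤ Real.exp 2 := by
    have h := Real.add_one_le_exp (1 : ℝ)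
    have h' : Real.exp 2 = Real.exp 1 * Real.exp 1 := by rw [← Real.exp_add]; norm_num
    nlinarith
  have hint : ∫ z : ℝ × ℝ, max (z.1 - x * (z.2 / N)) 0 ∂((chiSq D).prod (chiSq N)) ≤
      Real.exp (-L) := by
    refine hbound.trans ?_
    rw [h2]
    calc 4 * Real.exp (-1) * ((√(1 - 2 * (1 / 4) : ℝ))⁻¹ ^ D * Real.exp (-(L + 2 * D)))
        ≤ Real.exp 2 * Real.exp (-1) * (Real.exp (D / 2) * Real.exp (-(L + 2 * D))) := by gcongr
      _ = Real.exp (2 + -1 + (D / 2 + -(L + 2 * D))) := by simp only [Real.exp_add]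
      _ ≤ Real.exp (-L) := Real.exp_le_exp.2 (by linarith)
  rw [dkhi, integral_id_chiSq]
  calc (D : ℝ)⁻¹ * _ ≤ 1 * Real.exp (-L) := by
        gcongr
        exact inv_le_one_of_one_le₀ hD1
    _ = _ := one_mul _

lemma exists_dkhi_eq {D N : ℕ} (hD : 1 ≤ D) (hN : 1 ≤ N) {L : ℝ} (hL : 0 ≤ L) :
    ∃ x ∈ Set.Icc 0 (eDkhiBound D N L), dkhi D N x = Real.exp (-L) :=
  intermediate_value_Icc' (eDkhiBound_nonneg D N hL)
    ((continuousOn_dkhi D N).mono fun _ hx => hx.1)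
    ⟨dkhi_eDkhiBound_le hD hN hL, by
      rw [dkhi_zero N hD, Real.exp_le_one_iff]
      linarith⟩

lemma bddBelow_dkhi_solutions (D N : ℕ) (r : ℝ) : BddBelow {x : ℝ | 0 ≤ x ∧ dkhi D N x = r} :=
  ⟨0, fun _ hx => hx.1⟩

lemma eDkhi_nonneg (D N : ℕ) (r : ℝ) : 0 ≤ eDkhi D N r :=
  Real.sInf_nonneg fun _ hx => hx.1

lemma eDkhi_le {D N : ℕ} (hD : 1 ≤ D) (hN : 1 ≤ N) {L : ℝ} (hL : 0 ≤ L) :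
    eDkhi D N (Real.exp (-L)) ≤ eDkhiBound D N L := by
  obtain ⟨x, hx, hxr⟩ := exists_dkhi_eq hD hN hL
  exact (csInf_le (bddBelow_dkhi_solutions D N _) ⟨hx.1, hxr⟩).trans hx.2

/-- By continuity the solution set is closed, so its infimum is itself a solution; uniqueness is not
needed. -/
lemma dkhi_eDkhi {D N : ℕ} (hD : 1 ≤ D) (hN : 1 ≤ N) {L : ℝ} (hL : 0 ≤ L) :
    dkhi D N (eDkhi D N (Real.exp (-L))) = Real.exp (-L) := by
  obtain ⟨x, hx, hxr⟩ := exists_dkhi_eq hD hN hL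
  have hclosed : IsClosed {x : ℝ | 0 ≤ x ∧ dkhi D N x = Real.exp (-L)} :=
    (continuousOn_dkhi D N).preimage_isClosed_of_isClosed isClosed_Ici
      (isClosed_singleton (x := Real.exp (-L)))
  exact (hclosed.csInf_mem ⟨x, hx.1, hxr⟩ (bddBelow_dkhi_solutions D N _)).2

/-- The function `Dkhi` in terms of the projections of a standard Gaussian vector. -/
lemma integrable_posPart_projections {n D N : ℕ} (V : Submodule ℝ (Vec n))
    (hV : Module.finrank ℝ V = D) (hN : n - D = N) {x : ℝ} (hx : 0 ≤ x) :
    Integrable (fun e => max (‖V.starProjection e‖ ^ 2 - x * (‖e - V.starProjection e‖ ^ 2 / N)) 0)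
      (stdGaussian (Vec n)) := by
  have h := integrable_dkhi_integrand D N hx
  rw [← hN, ← map_normSq_projections V hV, hN] at h
  exact h.comp_measurable (by fun_prop)

lemma integral_posPart_projections {n D N : ℕ} (V : Submodule ℝ (Vec n)) (hD : 1 ≤ D)
    (hV : Module.finrank ℝ V = D) (hN : n - D = N) (x : ℝ) :
    ∫ e, max (‖V.starProjection e‖ ^ 2 - x * (‖e - V.starProjection e‖ ^ 2 / N)) 0
      ∂(stdGaussian (Vec n)) = D * dkhi D N x := by
  have : (D : ℝ) ≠ 0 := by positivity
  rw [dkhi, integral_id_chiSq, mul_inv_cancel_left₀ this, ← hN, ← map_normSq_projections V hV,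
    integral_map (by fun_prop) (by fun_prop)]

/-! ### Linear splines -/

/-- The pieces are half-open; continuity extends the affine formula to the right endpoint, which is
what glues neighbouring pieces. -/
lemma eq_affine_of_continuous {f : UnitIco → ℝ} (hf : Continuous f) {a b α β : ℝ} (ha : 0 ≤ a)
    (hab : a < b) (hb : b < 1) (h : ∀ t : UnitIco, (t : ℝ) ∈ Set.Ico a b → f t = α * t + β) :
    f ⟨b, ha.trans hab.le, hb⟩ = α * b + β := by
  have hpos (k : ℕ) : 0 < (b - a) * (1 / ((k : ℝ) + 1)) :=
    mul_pos (by linarith) (by positivity)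
  have hle (k : ℕ) : (b - a) * (1 / ((k : ℝ) + 1)) ≤ b - a :=
    mul_le_of_le_one_right (by linarith) (by
      rw [div_le_one (by positivity)]
      linarith [(k.cast_nonneg : (0 : ℝ) ≤ k)])
  let u : ℕ → UnitIco := fun k => ⟨b - (b - a) * (1 / ((k : ℝ) + 1)), by linarith [hle k], by
    linarith [hpos k]⟩
  have hlim : Filter.Tendsto (fun k : ℕ => b - (b - a) * (1 / ((k : ℝ) + 1))) Filter.atTop
      (nhds b) := by
    simpa using (tendsto_one_div_add_atTop_nhds_zero_nat.const_mul (b - a)).const_sub b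
  have hu : Filter.Tendsto u Filter.atTop (nhds ⟨b, ha.trans hab.le, hb⟩) :=
    tendsto_subtype_rng.2 hlim
  have h1 := (hf.tendsto _).comp hu
  have h2 : Filter.Tendsto (fun k => α * (u k : ℝ) + β) Filter.atTop (nhds (α * b + β)) :=
    (hlim.const_mul α).add_const β
  refine tendsto_nhds_unique h1 (h2.congr fun k => (h (u k) ⟨?_, ?_⟩).symm)
  · change a ≤ b - (b - a) * (1 / ((k : ℝ) + 1))
    linarith [hle k]
  · change b - (b - a) * (1 / ((k : ℝ) + 1)) < b
    linarith [hpos k]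

/-- On each piece the spline is affine and vanishes at two points. The auxiliary τ supplies the
second zero on the last piece, whose endpoint 1 is outside the domain. -/
lemma eq_zero_of_mem_splines {m : Finset ℝ} (hm : ∀ s ∈ m, s ∈ Set.Ioo (0 : ℝ) 1) {τ : UnitIco}
    (hτ0 : 0 < (τ : ℝ)) (hτ : ∀ s ∈ m, s < τ) {g : UnitIco → ℝ} (hg : g ∈ splines m)
    (h0 : ∀ t : UnitIco, (t : ℝ) = 0 ∨ (t : ℝ) ∈ m ∨ t = τ → g t = 0) : g = 0 := by
  obtain ⟨hcont, α, β, hαβ⟩ := hg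
  funext t
  set k := pieceIdx m t with hk
  -- `s₁` is the left endpoint of the piece containing `t`.
  obtain ⟨s₁, hs₁, hs₁max⟩ := (insert 0 (m.filter (fun s => s ≤ (t : ℝ)))).exists_max_image id
    (Finset.insert_nonempty _ _)
  have hs₁0 : 0 ≤ s₁ := hs₁max 0 (Finset.mem_insert_self _ _)
  have hs₁m : s₁ = 0 ∨ s₁ ∈ m ∧ s₁ ≤ t := by simpa using hs₁
  have hs₁t : s₁ ≤ t := by
    rcases hs₁m with h | h
    · rw [h]; exact t.2.1
    · exact h.2
  have hpiece₁ : ∀ u : ℝ, s₁ ≤ u → u ≤ t → pieceIdx m u = k := by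
    intro u hu hut
    refine congrArg Finset.card (Finset.filter_congr fun s hs => ⟨fun h => h.trans hut, fun h => ?_⟩)
    exact (hs₁max s (Finset.mem_insert_of_mem (Finset.mem_filter.2 ⟨hs, h⟩))).trans hu
  have hval₁ : α k * s₁ + β k = 0 := by
    have := hαβ ⟨s₁, hs₁0, hs₁t.trans_lt t.2.2⟩
    rw [h0 _ (hs₁m.imp id fun h => Or.inl h.1)] at this
    rw [this, ← hpiece₁ s₁ le_rfl hs₁t]
  have hval₂ : ∃ s₂, s₁ < s₂ ∧ α k * s₂ + β k = 0 := by
    by_cases hne : (m.filter (fun s => (t : ℝ) < s)).Nonempty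
    · obtain ⟨s₂, hs₂, hs₂min⟩ := Finset.exists_min_image _ id hne
      obtain ⟨hs₂m, hts₂⟩ := Finset.mem_filter.1 hs₂
      refine ⟨s₂, hs₁t.trans_lt hts₂, ?_⟩
      rw [← eq_affine_of_continuous hcont t.2.1 hts₂ (hm s₂ hs₂m).2 (α := α k) (β := β k)]
      · exact h0 _ (Or.inr (Or.inl hs₂m))
      · intro u hu
        have : pieceIdx m u = k := by
          refine congrArg Finset.card (Finset.filter_congr fun s hs => ⟨fun h => ?_, fun h =>
            h.trans hu.1⟩)
          by_contra hst
          exact absurd (hs₂min s (Finset.mem_filter.2 ⟨hs, not_le.1 hst⟩))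
            (not_le.2 (h.trans_lt hu.2))
        rw [hαβ u, this]
    · have hall : ∀ s ∈ m, s ≤ t := by
        intro s hs
        by_contra h
        exact hne ⟨s, Finset.mem_filter.2 ⟨hs, not_le.1 h⟩⟩
      refine ⟨τ, ?_, ?_⟩
      · rcases hs₁m with h | h
        · rwa [h]
        · exact hτ _ h.1
      · have : pieceIdx m τ = k := congrArg Finset.card (Finset.filter_congr fun s hs =>
          iff_of_true (hτ s hs).le (hall s hs))
        rw [← this, ← hαβ τ, h0 τ (Or.inr (Or.inr rfl))]
  obtain ⟨s₂, hlt, hval₂⟩ := hval₂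
  have hα : α k = 0 := by
    have : α k * (s₂ - s₁) = 0 := by linarith
    exact (mul_eq_zero.1 this).resolve_right (by linarith)
  have hβ : β k = 0 := by simpa [hα] using hval₁
  rw [hαβ t, ← hk, hα, hβ]
  simp

lemma exists_upper_bound_lt_one {m : Finset ℝ} (hm : ∀ s ∈ m, s ∈ Set.Ioo (0 : ℝ) 1) :
    ∃ τ : UnitIco, 0 < (τ : ℝ) ∧ ∀ s ∈ m, s < τ := by
  obtain ⟨s₁, hs₁, hmax⟩ := (insert 0 m).exists_max_image id (Finset.insert_nonempty _ _)
  have h0 : 0 ≤ s₁ := hmax 0 (Finset.mem_insert_self _ _)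
  have h1 : s₁ < 1 := by
    rcases Finset.mem_insert.1 hs₁ with h | h
    · rw [h]; norm_num
    · exact (hm s₁ h).2
  refine ⟨⟨(s₁ + 1) / 2, by linarith, by linarith⟩, ?_, fun s hs => ?_⟩
  · change 0 < (s₁ + 1) / 2
    linarith
  · have : s ≤ s₁ := hmax s (Finset.mem_insert_of_mem hs)
    change s < (s₁ + 1) / 2
    linarith

/-- Evaluation at 0, at τ and at the knots is injective on the splines, so their dimension is at
most the number of these points. -/
lemma dimModel_le {n : ℕ} (x : Fin n → UnitIco) {m : Finset ℝ}
    (hm : ∀ s ∈ m, s ∈ Set.Ioo (0 : ℝ) 1) : dimModel x m ≤ m.card + 2 := by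
  obtain ⟨τ, hτ0, hτ⟩ := exists_upper_bound_lt_one hm
  let T : Finset ℝ := insert 0 (insert (τ : ℝ) m)
  have hT : ∀ t ∈ T, t ∈ Set.Ico (0 : ℝ) 1 := by
    intro t ht
    rcases Finset.mem_insert.1 ht with rfl | ht
    · simp
    · rcases Finset.mem_insert.1 ht with rfl | ht
      · exact τ.2
      · exact Set.Ioo_subset_Ico_self (hm t ht)
  let ev : splines m →ₗ[ℝ] (T → ℝ) :=
    LinearMap.funLeft ℝ ℝ (fun t : T => (⟨t, hT t t.2⟩ : UnitIco)) ∘ₗ (splines m).subtype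
  have hinj : Function.Injective ev := by
    rw [← LinearMap.ker_eq_bot, LinearMap.ker_eq_bot']
    rintro ⟨g, hg⟩ h
    refine Subtype.ext (eq_zero_of_mem_splines hm hτ0 hτ hg fun t ht => ?_)
    have htT : (t : ℝ) ∈ T := by
      rcases ht with h | h | h
      · simp [T, h]
      · simp [T, h]
      · simp [T, h]
    exact congrFun h ⟨t, htT⟩
  have : FiniteDimensional ℝ (splines m) := FiniteDimensional.of_injective ev hinj
  have h1 := LinearMap.finrank_le_finrank_of_injective hinj
  rw [Module.finrank_fintype_fun_eq_card, Fintype.card_coe] at h1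
  calc dimModel x m ≤ Module.finrank ℝ (splines m) := Submodule.finrank_map_le _ _
    _ ≤ T.card := h1
    _ ≤ m.card + 2 := (Finset.card_insert_le _ _).trans
        (Nat.succ_le_succ (Finset.card_insert_le _ _))

lemma affine_mem_splines (m : Finset ℝ) (α β : ℝ) :
    (fun t : UnitIco => α * (t : ℝ) + β) ∈ splines m :=
  ⟨by fun_prop, fun _ => α, fun _ => β, fun _ => rfl⟩

lemma hinge_mem_splines {m : Finset ℝ} {b : ℝ} (hb : b ∈ m) :
    (fun t : UnitIco => max ((t : ℝ) - b) 0) ∈ splines m := by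
  -- Only knots strictly below `b` are counted, so a piece index exceeds `r` exactly when the point
  -- is at or beyond `b`.
  set r := (m.filter (fun s => s < b)).card with hr
  refine ⟨by fun_prop, fun k => if k ≤ r then 0 else 1, fun k => if k ≤ r then 0 else -b,
    fun t => ?_⟩
  rcases lt_or_ge (t : ℝ) b with h | h
  · have : pieceIdx m t ≤ r := Finset.card_le_card fun s hs => by
      rw [Finset.mem_filter] at hs ⊢
      exact ⟨hs.1, hs.2.trans_lt h⟩
    simp only [if_pos this]
    rw [max_eq_right (by linarith)]
    simp
  · have : r < pieceIdx m t := Finset.card_lt_card <| by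
      rw [Finset.ssubset_iff_of_subset]
      · exact ⟨b, Finset.mem_filter.2 ⟨hb, h⟩, by simp⟩
      · intro s hs
        rw [Finset.mem_filter] at hs ⊢
        exact ⟨hs.1, (hs.2.trans_le h).le⟩
    simp only [if_neg (not_le.2 this)]
    rw [max_eq_left (by linarith)]
    ring

/-! ### Approximation of continuous piecewise linear functions -/

/-- Crossing a breakpoint a adds (slope jump)·(t - a) to the affine formula, since continuity there
fixes the jump of the intercept. Induction on the piece sums these terms, and the hinges of
breakpoints to the right of t vanish. -/
lemma eq_sum_hinges {q : ℕ} {f : UnitIco → ℝ} (hf : Continuous f) {a : Fin (q + 2) → ℝ}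
    {α β : Fin (q + 1) → ℝ} (ha : StrictMono a) (ha0 : a 0 = 0) (ha1 : a (Fin.last (q + 1)) = 1)
    (hfa : ∀ (i : Fin (q + 1)) (t : UnitIco),
      (t : ℝ) ∈ Set.Ico (a i.castSucc) (a i.succ) → f t = α i * t + β i) (t : UnitIco) :
    f t = α 0 * t + β 0 +
      ∑ i : Fin q, (α i.succ - α i.castSucc) * max ((t : ℝ) - a i.succ.castSucc) 0 := by
  have hpiece : ∀ (r : ℕ) (hr : r < q + 1), α ⟨r, hr⟩ * t + β ⟨r, hr⟩ = α 0 * t + β 0 +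
      ∑ i : Fin q, if (i : ℕ) < r then
        (α i.succ - α i.castSucc) * ((t : ℝ) - a i.succ.castSucc) else 0 := by
    intro r
    induction r with
    | zero => intro hr; simp
    | succ r ih =>
      intro hr
      have hrq : r < q := by omega
      let i₀ : Fin q := ⟨r, hrq⟩
      have hsplit : (∑ i : Fin q, if (i : ℕ) < r + 1 then
          (α i.succ - α i.castSucc) * ((t : ℝ) - a i.succ.castSucc) else 0) =
          (∑ i : Fin q, if (i : ℕ) < r then
            (α i.succ - α i.castSucc) * ((t : ℝ) - a i.succ.castSucc) else 0) +
          (α i₀.succ - α i₀.castSucc) * ((t : ℝ) - a i₀.succ.castSucc) := by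
        have : (α i₀.succ - α i₀.castSucc) * ((t : ℝ) - a i₀.succ.castSucc) =
            ∑ i : Fin q, if i = i₀ then
              (α i.succ - α i.castSucc) * ((t : ℝ) - a i.succ.castSucc) else 0 := by simp
        rw [this, ← Finset.sum_add_distrib]
        refine Finset.sum_congr rfl fun i _ => ?_
        by_cases h : i = i₀
        · subst h; simp [i₀]
        · have hne : (i : ℕ) ≠ r := fun h' => h (Fin.ext h')
          have : (i : ℕ) < r + 1 ↔ (i : ℕ) < r := by omega
          simp [h, this]
      rw [hsplit, ← add_assoc, ← ih (by omega)]
      have hmem : a i₀.succ.castSucc ∈ Set.Ico (0 : ℝ) 1 := by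
        constructor
        · rw [← ha0]; exact ha.monotone (Fin.zero_le _)
        · rw [← ha1]; exact ha (Fin.castSucc_lt_last _)
      have h1 := eq_affine_of_continuous hf
        (a := a i₀.castSucc.castSucc) (b := a i₀.succ.castSucc)
        (by rw [← ha0]; exact ha.monotone (Fin.zero_le _))
        (ha (by simp [Fin.lt_def])) hmem.2 (hfa i₀.castSucc)
      have h2 := hfa i₀.succ ⟨a i₀.succ.castSucc, hmem⟩ ⟨le_rfl, ha (by simp [Fin.lt_def])⟩
      rw [h1] at h2
      change α i₀.succ * t + β i₀.succ = α i₀.castSucc * t + β i₀.castSucc + _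
      simp only at h2
      linear_combination -h2
  obtain ⟨i, hi⟩ : ∃ i : Fin (q + 1), (t : ℝ) ∈ Set.Ico (a i.castSucc) (a i.succ) := by
    by_contra! hno
    have : ∀ i : Fin (q + 2), a i ≤ t := by
      intro i
      induction i using Fin.induction with
      | zero => rw [ha0]; exact t.2.1
      | succ i ih =>
        by_contra h
        exact hno i ⟨ih, not_le.1 h⟩
    have h := this (Fin.last _)
    rw [ha1] at h
    exact absurd t.2.2 (not_lt.2 h)
  rw [hfa i t hi, hpiece i i.2]
  congr 1
  refine Finset.sum_congr rfl fun k _ => ?_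
  split_ifs with h
  · rw [max_eq_left]
    have : a k.succ.castSucc ≤ a i.castSucc := ha.monotone (by
      rw [Fin.le_def]; simp; omega)
    linarith [hi.1]
  · rw [max_eq_right, mul_zero]
    have : a i.succ ≤ a k.succ.castSucc := ha.monotone (by
      rw [Fin.le_def]; simp; omega)
    linarith [hi.2]

/-- The slope jumps are kept and the breakpoints rounded down to the grid. Each hinge moves by at
most 2^(-j) uniformly, and the jumps add up to at most qR. -/
lemma exists_dyadic_spline_approx {q : ℕ} (hq : 1 ≤ q) {R : ℝ} {f : UnitIco → ℝ}
    (hf : f ∈ contPiecewiseLinear q R) (j : ℕ) :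
    ∃ m ⊆ dyadicGrid j, m.card ≤ q ∧ ∃ g ∈ splines m, ∀ t, |f t - g t| ≤ q * R / 2 ^ j := by
  classical
  obtain ⟨hcont, a, α, β, ha, ha0, ha1, hfa, hR⟩ := hf
  have hmem (i : Fin q) : a i.succ.castSucc ∈ Set.Ico (0 : ℝ) 1 := by
    constructor
    · rw [← ha0]; exact ha.monotone (Fin.zero_le _)
    · rw [← ha1]; exact ha (Fin.castSucc_lt_last _)
  let b : Fin q → ℝ := fun i => (⌊a i.succ.castSucc * 2 ^ j⌋₊ : ℝ) / 2 ^ j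
  let δ : Fin q → ℝ := fun i => α i.succ - α i.castSucc
  have h2 : (0 : ℝ) < 2 ^ j := by positivity
  have hδ : ∑ i, |δ i| ≤ q * R := by
    have hq' : (0 : ℝ) < q := by exact_mod_cast hq
    rw [one_div, inv_mul_le_iff₀ hq'] at hR
    exact hR
  have hab (i : Fin q) : |a i.succ.castSucc - b i| ≤ 1 / 2 ^ j := by
    have h1 := Nat.floor_le (mul_nonneg (hmem i).1 h2.le)
    have h3 := (Nat.lt_floor_add_one (a i.succ.castSucc * 2 ^ j)).le
    have e : a i.succ.castSucc - b i =
        (a i.succ.castSucc * 2 ^ j - ⌊a i.succ.castSucc * 2 ^ j⌋₊) / 2 ^ j := by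
      simp only [b]
      field_simp
    rw [e, abs_of_nonneg (div_nonneg (by linarith) h2.le)]
    gcongr
    linarith
  -- A breakpoint may round to 0, which is not a grid knot; its hinge is then `t` itself, an affine
  -- function on [0, 1).
  refine ⟨(Finset.univ.image b).erase 0, ?_, ?_, fun t => α 0 * t + β 0 +
    ∑ i, δ i * max ((t : ℝ) - b i) 0, ?_, fun t => ?_⟩
  · intro s hs
    obtain ⟨hs0, hs⟩ := Finset.mem_erase.1 hs
    obtain ⟨i, -, rfl⟩ := Finset.mem_image.1 hs
    refine Finset.mem_image.2 ⟨⌊a i.succ.castSucc * 2 ^ j⌋₊, Finset.mem_Icc.2 ⟨?_, ?_⟩, rfl⟩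
    · rw [Nat.one_le_iff_ne_zero]
      intro h
      exact hs0 (by simp only [b, h, Nat.cast_zero, zero_div])
    · have h3 : ⌊a i.succ.castSucc * 2 ^ j⌋₊ < 2 ^ j := by
        rw [Nat.floor_lt (mul_nonneg (hmem i).1 h2.le)]
        push_cast
        exact mul_lt_of_lt_one_left h2 (hmem i).2
      omega
  · calc _ ≤ (Finset.univ.image b).card := Finset.card_erase_le
      _ ≤ q := by simpa using Finset.card_image_le (s := Finset.univ) (f := b)
  · have hsum : (∑ i, δ i • fun t : UnitIco => max ((t : ℝ) - b i) 0) ∈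
        splines ((Finset.univ.image b).erase 0) := by
      refine Submodule.sum_mem _ fun i _ => Submodule.smul_mem _ _ ?_
      by_cases h : b i = 0
      · convert affine_mem_splines ((Finset.univ.image b).erase 0) 1 0 using 2 with t
        rw [h, sub_zero, max_eq_left t.2.1]
        ring
      · exact hinge_mem_splines (Finset.mem_erase.2 ⟨h, Finset.mem_image_of_mem _
          (Finset.mem_univ i)⟩)
    convert (splines _).add_mem (affine_mem_splines _ (α 0) (β 0)) hsum using 1
    ext t
    simp
  · rw [eq_sum_hinges hcont ha ha0 ha1 hfa t, add_sub_add_left_eq_sub, ← Finset.sum_sub_distrib]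
    calc |∑ i, (δ i * max ((t : ℝ) - a i.succ.castSucc) 0 - δ i * max ((t : ℝ) - b i) 0)|
        ≤ ∑ i, |δ i| * (1 / 2 ^ j) := by
          refine (Finset.abs_sum_le_sum_abs _ _).trans (Finset.sum_le_sum fun i _ => ?_)
          rw [← mul_sub, abs_mul]
          gcongr
          refine (abs_max_sub_max_le_abs _ _ _).trans ?_
          rw [sub_sub_sub_cancel_left, abs_sub_comm]
          exact hab i
      _ = (∑ i, |δ i|) * (1 / 2 ^ j) := by rw [Finset.sum_mul]
      _ ≤ q * R * (1 / 2 ^ j) := by gcongr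
      _ = _ := by ring

/-! ### The collection of models and the weights -/

lemma dyadicGrid_subset_Ioo {j : ℕ} {s : ℝ} (hs : s ∈ dyadicGrid j) : s ∈ Set.Ioo (0 : ℝ) 1 := by
  obtain ⟨k, hk, rfl⟩ := Finset.mem_image.1 hs
  obtain ⟨h1, h2⟩ := Finset.mem_Icc.1 hk
  have h3 : k < 2 ^ j := by
    have := Nat.one_le_two_pow (n := j)
    omega
  have h4 : (k : ℝ) < 2 ^ j := by exact_mod_cast h3
  have h5 : (0 : ℝ) < k := by exact_mod_cast h1
  exact ⟨by positivity, (div_lt_one (by positivity)).2 h4⟩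

lemma card_dyadicGrid (j : ℕ) : (dyadicGrid j).card = 2 ^ j - 1 := by
  rw [dyadicGrid, Finset.card_image_of_injective]
  · simp
  · intro a b h
    have h2 : (2 : ℝ) ^ j ≠ 0 := by positivity
    simpa [div_left_inj' h2] using h

lemma exists_subset_dyadicGrid {p : ℕ} {m : Finset ℝ} (hm : m ∈ models p) :
    m.card ≤ p ∧ ∃ j, 1 ≤ j ∧ m ⊆ dyadicGrid j := by
  rcases hm with hm | hm
  · simp only [Set.mem_iUnion] at hm
    obtain ⟨j, hj, q, hq, hm, hc⟩ := hm
    exact ⟨hc ▸ hq.2.trans (min_le_right _ _), j, hj, hm⟩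
  · rw [Set.mem_singleton_iff] at hm
    subst hm
    exact ⟨by simp, 1, le_rfl, by simp⟩

lemma mem_models {p j : ℕ} (hj : 1 ≤ j) {m : Finset ℝ} (hm : m ⊆ dyadicGrid j)
    (hp : m.card ≤ p) : m ∈ models p := by
  by_cases h : m = ∅
  · exact Or.inr h
  · left
    simp only [Set.mem_iUnion]
    refine ⟨j, hj, m.card, ⟨?_, le_min ?_ hp⟩, hm, rfl⟩
    · exact Finset.card_pos.2 (Finset.nonempty_iff_ne_empty.2 h)
    · exact card_dyadicGrid j ▸ Finset.card_le_card hm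

lemma models_subset_Ioo {p : ℕ} {m : Finset ℝ} (hm : m ∈ models p) :
    ∀ s ∈ m, s ∈ Set.Ioo (0 : ℝ) 1 := by
  obtain ⟨-, j, -, h⟩ := exists_subset_dyadicGrid hm
  exact fun s hs => dyadicGrid_subset_Ioo (h hs)

lemma empty_mem_models (p : ℕ) : ∅ ∈ models p := Or.inr rfl

lemma countable_models (p : ℕ) : (models p).Countable := by
  have h : (⋃ j : ℕ, ((dyadicGrid j).powerset : Set (Finset ℝ))).Countable :=
    Set.countable_iUnion fun j => (Finset.countable_toSet _)
  refine h.mono ?_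
  intro m hm
  obtain ⟨-, j, -, h⟩ := exists_subset_dyadicGrid hm
  exact Set.mem_iUnion.2 ⟨j, Finset.mem_coe.2 (Finset.mem_powerset.2 h)⟩

instance (p : ℕ) : Countable (models p) := (countable_models p).to_subtype

lemma levelWeight_nonneg (j q : ℕ) : 0 ≤ levelWeight j q := by
  have h1 := Real.log_natCast_nonneg ((2 ^ j - 1).choose q)
  have h2 := Real.log_natCast_nonneg j
  rw [levelWeight]
  positivity

lemma bddBelow_levelWeights (m : Finset ℝ) :
    BddBelow {l : ℝ | ∃ j q : ℕ, 1 ≤ j ∧ q ≤ 2 ^ j - 1 ∧ m ∈ knotSets j q ∧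
      l = levelWeight j q} := by
  refine ⟨0, ?_⟩
  rintro _ ⟨j, q, -, -, -, rfl⟩
  exact levelWeight_nonneg j q

lemma weight_nonneg (m : Finset ℝ) : 0 ≤ weight m := by
  refine Real.sInf_nonneg ?_
  rintro _ ⟨j, q, -, -, -, rfl⟩
  exact levelWeight_nonneg j q

lemma mem_levelWeights {j : ℕ} (hj : 1 ≤ j) {m : Finset ℝ} (hm : m ⊆ dyadicGrid j) :
    levelWeight j m.card ∈ {l : ℝ | ∃ j q : ℕ, 1 ≤ j ∧ q ≤ 2 ^ j - 1 ∧ m ∈ knotSets j q ∧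
      l = levelWeight j q} :=
  ⟨j, m.card, hj, card_dyadicGrid j ▸ Finset.card_le_card hm, ⟨hm, rfl⟩, rfl⟩

lemma weight_le {j : ℕ} (hj : 1 ≤ j) {m : Finset ℝ} (hm : m ⊆ dyadicGrid j) :
    weight m ≤ levelWeight j m.card :=
  csInf_le (bddBelow_levelWeights m) (mem_levelWeights hj hm)

/-- The slack 1 dispenses with attainment of the infimum and costs only a factor e in the sum of the
weights. -/
lemma exists_levelWeight_lt {p : ℕ} {m : Finset ℝ} (hm : m ∈ models p) :
    ∃ j, m ⊆ dyadicGrid (j + 1) ∧ levelWeight (j + 1) m.card < weight m + 1 := by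
  obtain ⟨-, j, hj, h⟩ := exists_subset_dyadicGrid hm
  obtain ⟨_, ⟨j', q, hj', -, ⟨hm', rfl⟩, rfl⟩, hlt⟩ :=
    exists_lt_of_csInf_lt ⟨_, mem_levelWeights hj h⟩ (lt_add_one (weight m))
  obtain ⟨i, rfl⟩ := Nat.exists_eq_add_of_le' hj'
  exact ⟨i, hm', hlt⟩

lemma summable_card_mul_exp : Summable fun q : ℕ => ((q : ℝ) + 3) * Real.exp (-q) := by
  have h := (Real.summable_pow_mul_exp_neg_nat_mul 1 one_pos).add
    ((Real.summable_pow_mul_exp_neg_nat_mul 0 one_pos).mul_left 3)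
  refine h.congr fun q => ?_
  simp
  ring

/-- The log-binomial term of the weight exactly cancels the number of q-subsets of the grid, leaving
(q + 3) exp(-q) divided by the squared level. -/
lemma sum_exp_neg_levelWeight_le (j : ℕ) :
    ∑ m ∈ (dyadicGrid (j + 1)).powerset,
      ((m.card : ℝ) + 3) * Real.exp (-levelWeight (j + 1) m.card) ≤
      (∑' q : ℕ, ((q : ℝ) + 3) * Real.exp (-q)) * (1 / ((j + 1 : ℕ) : ℝ) ^ 2) := by
  rw [Finset.sum_powerset_apply_card
    (fun q : ℕ => ((q : ℝ) + 3) * Real.exp (-levelWeight (j + 1) q)), card_dyadicGrid]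
  calc _ ≤ ∑ q ∈ Finset.range (2 ^ (j + 1) - 1 + 1),
        (((q : ℝ) + 3) * Real.exp (-q)) * (1 / ((j + 1 : ℕ) : ℝ) ^ 2) := by
        refine Finset.sum_le_sum fun q hq => le_of_eq ?_
        have hc : (0 : ℝ) < (2 ^ (j + 1) - 1).choose q := by
          exact_mod_cast Nat.choose_pos (Nat.lt_succ_iff.1 (Finset.mem_range.1 hq))
        have hj : (0 : ℝ) < ((j + 1 : ℕ) : ℝ) := by positivity
        have h2 : Real.exp (2 * Real.log ((j + 1 : ℕ) : ℝ)) = ((j + 1 : ℕ) : ℝ) ^ 2 := by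
          rw [mul_comm, Real.exp_mul, Real.exp_log hj]
          norm_num
        rw [levelWeight, neg_add, neg_add, Real.exp_add, Real.exp_add, Real.exp_neg (Real.log _),
          Real.exp_log hc, Real.exp_neg (2 * _), h2, nsmul_eq_mul]
        field_simp
    _ = (∑ q ∈ Finset.range (2 ^ (j + 1) - 1 + 1), ((q : ℝ) + 3) * Real.exp (-q)) *
        (1 / ((j + 1 : ℕ) : ℝ) ^ 2) := by rw [Finset.sum_mul]
    _ ≤ _ := by
        gcongr
        exact summable_card_mul_exp.sum_le_tsum _ fun q _ => by positivity

/-- The factor card + 3 dominates D_m + 1. Each model is sent injectively to a pair (level, knots)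
with nearly optimal weight, and summing over all such pairs converges because of the inverse squared
levels. -/
lemma exists_tsum_exp_neg_weight_le :
    ∃ C₀ : ℝ, 0 ≤ C₀ ∧ ∀ p : ℕ, ∑' m : models p,
      ENNReal.ofReal ((((m : Finset ℝ).card : ℝ) + 3) * Real.exp (-weight m)) ≤
        ENNReal.ofReal C₀ := by
  set A := ∑' q : ℕ, ((q : ℝ) + 3) * Real.exp (-q)
  have hA : 0 ≤ A := tsum_nonneg fun q => by positivity
  have hsum : Summable fun j : ℕ => 1 / ((j + 1 : ℕ) : ℝ) ^ 2 :=
    (summable_nat_add_iff 1).2 (Real.summable_one_div_nat_pow.2 one_lt_two)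
  have hsum' : Summable fun j : ℕ => Real.exp 1 * (A * (1 / ((j + 1 : ℕ) : ℝ) ^ 2)) :=
    (hsum.mul_left A).mul_left _
  refine ⟨∑' j : ℕ, Real.exp 1 * (A * (1 / ((j + 1 : ℕ) : ℝ) ^ 2)),
    tsum_nonneg fun j => by positivity, fun p => ?_⟩
  have hex (m : models p) := exists_levelWeight_lt m.2
  choose lev hlev hlt using hex
  let F : (Σ j : ℕ, (dyadicGrid (j + 1)).powerset) → ℝ≥0∞ := fun z =>
    ENNReal.ofReal (Real.exp 1 * ((((z.2 : Finset ℝ).card : ℝ) + 3) *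
      Real.exp (-levelWeight (z.1 + 1) (z.2 : Finset ℝ).card)))
  let ι : models p → Σ j : ℕ, (dyadicGrid (j + 1)).powerset := fun m =>
    ⟨lev m, ⟨m, Finset.mem_powerset.2 (hlev m)⟩⟩
  have hι : Function.Injective ι := by
    intro m m' h
    have := congrArg (fun z : Σ j : ℕ, (dyadicGrid (j + 1)).powerset => (z.2 : Finset ℝ)) h
    exact Subtype.ext this
  calc _ ≤ ∑' m : models p, F (ι m) := by
        refine ENNReal.tsum_le_tsum fun m => ENNReal.ofReal_le_ofReal ?_
        rw [mul_left_comm, ← Real.exp_add]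
        gcongr
        change _ ≤ 1 + -levelWeight (lev m + 1) (m : Finset ℝ).card
        linarith [hlt m]
    _ ≤ ∑' z, F z := ENNReal.tsum_comp_le_tsum_of_injective hι F
    _ = ∑' (j : ℕ) (m : (dyadicGrid (j + 1)).powerset), F ⟨j, m⟩ :=
        ENNReal.tsum_sigma (fun j m => F ⟨j, m⟩)
    _ ≤ ∑' j : ℕ, ENNReal.ofReal (Real.exp 1 * (A * (1 / ((j + 1 : ℕ) : ℝ) ^ 2))) := by
        refine ENNReal.tsum_le_tsum fun j => ?_
        rw [Finset.tsum_subtype (dyadicGrid (j + 1)).powerset (fun m => ENNReal.ofReal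
          (Real.exp 1 * (((m.card : ℝ) + 3) * Real.exp (-levelWeight (j + 1) m.card)))),
          ← ENNReal.ofReal_sum_of_nonneg fun m _ => by positivity, ← Finset.mul_sum]
        exact ENNReal.ofReal_le_ofReal (mul_le_mul_of_nonneg_left
          (sum_exp_neg_levelWeight_le j) (Real.exp_pos 1).le)
    _ = _ := (ENNReal.ofReal_tsum_of_nonneg (fun j => by positivity) hsum').symm

/-- Take 2^j between qs and 2qs. Then the binomial is at most (2qs)^q'/q'! ≤ s^q exp(2q), and log j
is at most 2(q + log s); together with q' this gives at most 7q + 5q log s. -/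
lemma exists_level {q : ℕ} (hq : 1 ≤ q) {s : ℝ} (hs : 1 ≤ s) :
    ∃ j, 1 ≤ j ∧ q * s ≤ 2 ^ j ∧
      ∀ q' ≤ q, q' ≤ 2 ^ j - 1 → levelWeight j q' ≤ 7 * (q * (1 + Real.log s)) := by
  have hq1 : (1 : ℝ) ≤ q := by exact_mod_cast hq
  have hqs : 1 ≤ q * s := one_le_mul_of_one_le_of_one_le hq1 hs
  obtain ⟨i, hi, hi'⟩ := exists_nat_pow_near hqs one_lt_two
  refine ⟨i + 1, by omega, hi'.le, fun q' hq' hq'2 => ?_⟩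
  have hq'q : (q' : ℝ) ≤ q := by exact_mod_cast hq'
  have hlogs : 0 ≤ Real.log s := Real.log_nonneg hs
  have hbinom : Real.log ((2 ^ (i + 1) - 1).choose q') ≤ q * Real.log s + 2 * q := by
    have hpos : (0 : ℝ) < (2 ^ (i + 1) - 1).choose q' := by exact_mod_cast Nat.choose_pos hq'2
    rw [Real.log_le_iff_le_exp hpos]
    calc (((2 ^ (i + 1) - 1).choose q' : ℕ) : ℝ) ≤ ((2 ^ (i + 1)).choose q' : ℕ) := by
          exact_mod_cast Nat.choose_mono q' (Nat.sub_le _ _)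
      _ ≤ ((2 ^ (i + 1) : ℕ) : ℝ) ^ q' / q'.factorial := Nat.choose_le_pow_div _ _
      _ ≤ (s * (2 * q)) ^ q' / q'.factorial := by
          gcongr
          push_cast
          rw [pow_succ]
          linarith
      _ = s ^ q' * ((2 * q : ℝ) ^ q' / q'.factorial) := by rw [mul_pow, mul_div_assoc]
      _ ≤ s ^ q * Real.exp (2 * q) := by
          gcongr
          exact Real.pow_div_factorial_le_exp _ (by positivity) _
      _ = Real.exp (q * Real.log s + 2 * q) := by
          rw [Real.exp_add, Real.exp_nat_mul, Real.exp_log (by linarith)]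
  have hlog : Real.log ((i + 1 : ℕ) : ℝ) ≤ 2 * (q + Real.log s) := by
    have h1 : Real.log ((i + 1 : ℕ) : ℝ) ≤ i := by
      have := Real.log_le_sub_one_of_pos (x := ((i + 1 : ℕ) : ℝ)) (by positivity)
      push_cast at this ⊢
      linarith
    have h2 : i * Real.log 2 ≤ Real.log q + Real.log s := by
      rw [← Real.log_pow, ← Real.log_mul (by positivity) (by positivity)]
      exact Real.log_le_log (by positivity) hi
    have h3 : Real.log q ≤ q - 1 := Real.log_le_sub_one_of_pos (by linarith)
    have h4 : (1 : ℝ) / 2 ≤ Real.log 2 := by linarith [Real.log_two_gt_d9]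
    have h5 : (i : ℝ) * (1 / 2) ≤ i * Real.log 2 := by gcongr
    linarith
  have h6 : Real.log s ≤ q * Real.log s := le_mul_of_one_le_left hlogs hq1
  rw [levelWeight]
  linarith

/-! ### Geometry of the least-squares estimators -/

/-- A dimension is added even when μ already lies in S, so that the degrees of freedom always match
those in the penalty. -/
lemma exists_submodule_finrank_succ {n : ℕ} (S : Submodule ℝ (Vec n)) (μ : Vec n)
    (h : Module.finrank ℝ S < n) :
    ∃ V : Submodule ℝ (Vec n), S ≤ V ∧ μ ∈ V ∧ Module.finrank ℝ V = Module.finrank ℝ S + 1 := by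
  by_cases hμ : μ ∈ S
  · obtain ⟨v, hv⟩ : ∃ v, v ∉ S := by
      by_contra! hall
      have htop : S = ⊤ := eq_top_iff.2 fun v _ => hall v
      rw [htop, finrank_top, finrank_euclideanSpace_fin] at h
      exact lt_irrefl _ h
    exact ⟨_, le_sup_left, Submodule.mem_sup_left hμ, Submodule.finrank_sup_span_singleton hv⟩
  · exact ⟨S ⊔ Submodule.span ℝ {μ}, le_sup_left,
      Submodule.mem_sup_right (Submodule.mem_span_singleton_self μ),
      Submodule.finrank_sup_span_singleton hμ⟩

lemma norm_sub_starProjection_le {n : ℕ} (V : Submodule ℝ (Vec n)) (y : Vec n) {v : Vec n}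
    (hv : v ∈ V) : ‖y - V.starProjection y‖ ≤ ‖y - v‖ := by
  rw [Submodule.starProjection_minimal]
  exact ciInf_le ⟨0, by rintro _ ⟨w, rfl⟩; positivity⟩ (⟨v, hv⟩ : V)

lemma sq_norm_residual_ge {n : ℕ} {S V : Submodule ℝ (Vec n)} (hSV : S ≤ V) {μ : Vec n}
    (hμ : μ ∈ V) (σ : ℝ) (e : Vec n) :
    σ ^ 2 * ‖e - V.starProjection e‖ ^ 2 ≤
      ‖μ + σ • e - S.starProjection (μ + σ • e)‖ ^ 2 := by
  have h := norm_sub_starProjection_le V (μ + σ • e)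
    (hSV (S.starProjection_apply_mem (μ + σ • e)))
  have h2 : μ + σ • e - V.starProjection (μ + σ • e) = σ • (e - V.starProjection e) := by
    rw [map_add, map_smul, Submodule.starProjection_eq_self_iff.2 hμ, smul_sub]
    abel
  rw [h2] at h
  calc σ ^ 2 * ‖e - V.starProjection e‖ ^ 2 = ‖σ • (e - V.starProjection e)‖ ^ 2 := by
        rw [norm_smul, mul_pow, Real.norm_eq_abs, sq_abs]
    _ ≤ _ := by gcongr

/-- The loss of a least-squares estimator is controlled by its penalized residual sum of
squares. -/
lemma loss_le_penalized_residual {n : ℕ} {S V : Submodule ℝ (Vec n)} (hSV : S ≤ V) {μ : Vec n}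
    (hμ : μ ∈ V) {σ K a : ℝ} (hσ : 0 < σ) (hK : 1 < K) (ha : 0 ≤ a) (e : Vec n) :
    (1 - 1 / K) * ‖μ - S.starProjection (μ + σ • e)‖ ^ 2 + σ ^ 2 * ‖e‖ ^ 2 ≤
      ‖μ + σ • e - S.starProjection (μ + σ • e)‖ ^ 2 * (1 + K * a) +
        K * σ ^ 2 * max (‖V.starProjection e‖ ^ 2 - a * ‖e - V.starProjection e‖ ^ 2) 0 := by
  have hres := sq_norm_residual_ge hSV hμ σ e
  set P := S.starProjection (μ + σ • e) with hP
  have hK0 : 0 < K := by linarith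
  set v := P - μ with hv
  have hvV : v ∈ V := V.sub_mem (hSV (S.starProjection_apply_mem _)) hμ
  have hloss : ‖μ - P‖ = ‖v‖ := by rw [hv, norm_sub_rev]
  have hexp : ‖μ + σ • e - P‖ ^ 2 = σ ^ 2 * ‖e‖ ^ 2 - 2 * (σ * inner ℝ e v) + ‖v‖ ^ 2 := by
    have : μ + σ • e - P = σ • e - v := by rw [hv]; abel
    rw [this, norm_sub_sq_real, norm_smul, inner_smul_left, mul_pow, Real.norm_eq_abs, sq_abs]
    simp
  -- The error `v` lies in `V`, so it only sees the part of the noise in `V`.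
  have hinner : inner ℝ e v = inner ℝ (V.starProjection e) v := by
    rw [Submodule.inner_starProjection_left_eq_right, Submodule.starProjection_eq_self_iff.2 hvV]
  have hcs := real_inner_le_norm (V.starProjection e) v
  set A := ‖V.starProjection e‖
  set B := ‖e - V.starProjection e‖ ^ 2
  -- The weights K and 1/K leave the fraction 1 - 1/K of the loss and give the noise the same factor
  -- K as the penalty.
  have hamgm : 2 * (σ * inner ℝ e v) ≤ K * σ ^ 2 * A ^ 2 + 1 / K * ‖v‖ ^ 2 := by
    have h1 : 2 * (σ * inner ℝ e v) ≤ 2 * (σ * (A * ‖v‖)) := by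
      rw [hinner]; gcongr
    have h2 : 0 ≤ 1 / K * (K * σ * A - ‖v‖) ^ 2 := by positivity
    have h3 : 1 / K * (K * σ * A - ‖v‖) ^ 2 =
        K * σ ^ 2 * A ^ 2 + 1 / K * ‖v‖ ^ 2 - 2 * (σ * (A * ‖v‖)) := by
      field_simp
      ring
    linarith
  have hmax : K * σ ^ 2 * (A ^ 2 - a * B) ≤ K * σ ^ 2 * max (A ^ 2 - a * B) 0 := by
    gcongr
    exact le_max_left _ _
  have hpen : K * a * (σ ^ 2 * B) ≤ K * a * ‖μ + σ • e - P‖ ^ 2 := by gcongr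
  rw [hloss]
  linarith

/-! ### Moments of the residuals -/

lemma integrable_normSq_stdGaussian (n : ℕ) :
    Integrable (fun e : Vec n => ‖e‖ ^ 2) (stdGaussian (Vec n)) :=
  (IsGaussian.memLp_two_id (μ := stdGaussian (Vec n))).integrable_norm_pow two_ne_zero

lemma integral_normSq_stdGaussian (n : ℕ) :
    ∫ e : Vec n, ‖e‖ ^ 2 ∂(stdGaussian (Vec n)) = n := by
  rw [← integral_id_chiSq n, chiSq, integral_map (by fun_prop) (by fun_prop)]

lemma integrable_normSq_of_le {n : ℕ} {μ : Vec n} {σ : ℝ} {g : Vec n → Vec n} (hg : Measurable g)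
    (h : ∀ e, ‖g e‖ ≤ ‖μ‖ + ‖σ • e‖) :
    Integrable (fun e => ‖g e‖ ^ 2) (stdGaussian (Vec n)) := by
  have hdom : Integrable (fun e : Vec n => 2 * ‖μ‖ ^ 2 + 2 * σ ^ 2 * ‖e‖ ^ 2)
      (stdGaussian (Vec n)) :=
    (integrable_const _).add ((integrable_normSq_stdGaussian n).const_mul _)
  refine hdom.mono' (hg.norm.pow_const 2).aestronglyMeasurable
    (Filter.Eventually.of_forall fun e => ?_)
  rw [Real.norm_of_nonneg (by positivity)]
  have h1 := h e
  rw [norm_smul, Real.norm_eq_abs] at h1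
  calc ‖g e‖ ^ 2 ≤ (‖μ‖ + |σ| * ‖e‖) ^ 2 := by gcongr
    _ ≤ 2 * ‖μ‖ ^ 2 + 2 * (|σ| * ‖e‖) ^ 2 := by nlinarith [sq_nonneg (‖μ‖ - |σ| * ‖e‖)]
    _ = _ := by rw [mul_pow, sq_abs]; ring

lemma norm_sub_starProjection_le_norm {n : ℕ} (S : Submodule ℝ (Vec n)) (y : Vec n) :
    ‖y - S.starProjection y‖ ≤ ‖y‖ := by
  simpa using norm_sub_starProjection_le S y S.zero_mem

lemma integrable_sq_residual {n : ℕ} (S : Submodule ℝ (Vec n)) (μ : Vec n) (σ : ℝ) :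
    Integrable (fun e => ‖μ + σ • e - S.starProjection (μ + σ • e)‖ ^ 2) (stdGaussian (Vec n)) :=
  integrable_normSq_of_le (by fun_prop) fun _ =>
    (norm_sub_starProjection_le_norm S _).trans (norm_add_le _ _)

lemma integral_sq_residual {n : ℕ} (S : Submodule ℝ (Vec n)) (μ : Vec n) (σ : ℝ) :
    ∫ e, ‖μ + σ • e - S.starProjection (μ + σ • e)‖ ^ 2 ∂(stdGaussian (Vec n)) =
      ‖μ - S.starProjection μ‖ ^ 2 + σ ^ 2 * (n - Module.finrank ℝ S : ℕ) := by
  have hexp (e : Vec n) : ‖μ + σ • e - S.starProjection (μ + σ • e)‖ ^ 2 =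
      ‖μ - S.starProjection μ‖ ^ 2 + 2 * σ * (innerSL ℝ (μ - S.starProjection μ) e) +
        σ ^ 2 * ‖e - S.starProjection e‖ ^ 2 := by
    have h1 : μ + σ • e - S.starProjection (μ + σ • e) =
        (μ - S.starProjection μ) + σ • (e - S.starProjection e) := by
      rw [map_add, map_smul, smul_sub]; abel
    have h2 : inner ℝ (μ - S.starProjection μ) (e - S.starProjection e) =
        inner ℝ (μ - S.starProjection μ) e := by
      rw [inner_sub_right, Submodule.starProjection_inner_eq_zero _ _
        (S.starProjection_apply_mem e), sub_zero]
    rw [h1, norm_add_sq_real, inner_smul_right, norm_smul, mul_pow, Real.norm_eq_abs, sq_abs, h2,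
      innerSL_apply_apply]
    ring
  have hint : Integrable (fun e => innerSL ℝ (μ - S.starProjection μ) e) (stdGaussian (Vec n)) :=
    (innerSL ℝ (μ - S.starProjection μ)).integrable_comp IsGaussian.integrable_id
  have hint2 : Integrable (fun e => ‖e - S.starProjection e‖ ^ 2) (stdGaussian (Vec n)) := by
    simpa using integrable_sq_residual S 0 1
  have hN : ∫ e, ‖e - S.starProjection e‖ ^ 2 ∂(stdGaussian (Vec n)) =
      (n - Module.finrank ℝ S : ℕ) := by
    have h := integral_fun_snd (μ := chiSq (Module.finrank ℝ S))
      (ν := chiSq (n - Module.finrank ℝ S)) (fun u : ℝ => u)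
    rw [← map_normSq_projections S rfl, integral_map (by fun_prop) (by fun_prop),
      integral_id_chiSq] at h
    simpa using h
  simp_rw [hexp]
  have hint3 : Integrable (fun e => ‖μ - S.starProjection μ‖ ^ 2 +
      2 * σ * (innerSL ℝ (μ - S.starProjection μ) e)) (stdGaussian (Vec n)) :=
    (integrable_const _).add (hint.const_mul _)
  rw [integral_add hint3 (hint2.const_mul _), integral_add (integrable_const _) (hint.const_mul _),
    integral_const_mul, integral_const_mul,
    integral_strongDual_stdGaussian, hN]
  simp

/-! ### The penalized criterion -/

/-- The solution of the equation that defines the penalty of the model `m`. -/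
noncomputable def penaltyRoot {n : ℕ} (x : Fin n → UnitIco) (m : Finset ℝ) : ℝ :=
  eDkhi (dimModel x m + 1) (codimModel x m - 1) (Real.exp (-weight m))

lemma penaltyRoot_nonneg {n : ℕ} (x : Fin n → UnitIco) (m : Finset ℝ) : 0 ≤ penaltyRoot x m :=
  eDkhi_nonneg _ _ _

/-- The factor N_m/(N_m - 1) in the penalty turns division by N_m into division by N_m - 1, the
normalization inside Dkhi. -/
lemma crit_eq {n : ℕ} (K : ℝ) (x : Fin n → UnitIco) {m : Finset ℝ} (hN : 2 ≤ codimModel x m)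
    (y : Vec n) :
    crit K x m y = ‖y - (model x m).starProjection y‖ ^ 2 *
      (1 + K * (penaltyRoot x m / (codimModel x m - 1 : ℕ))) := by
  have h1 : ((codimModel x m - 1 : ℕ) : ℝ) = codimModel x m - 1 := by
    rw [Nat.cast_sub (by omega)]; simp
  have h2 : (codimModel x m : ℝ) ≠ 0 := by
    have : 0 < codimModel x m := by omega
    positivity
  rw [crit, penalty, lsEstimator, h1, penaltyRoot]
  congr 2
  field_simp

lemma measurable_crit {n : ℕ} (K : ℝ) (x : Fin n → UnitIco) (m : Finset ℝ) :
    Measurable (crit K x m) := by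
  unfold crit lsEstimator
  fun_prop

section Collection

variable {n p : ℕ} (x : Fin n → UnitIco)

lemma dimModel_le_of_mem_models {m : Finset ℝ} (hm : m ∈ models p) : dimModel x m ≤ p + 2 :=
  (dimModel_le x (models_subset_Ioo hm)).trans
    (Nat.add_le_add_right (exists_subset_dyadicGrid hm).1 2)

lemma codimModel_ge (hp : p + 9 ≤ n) {m : Finset ℝ} (hm : m ∈ models p) : 7 ≤ codimModel x m := by
  have := dimModel_le_of_mem_models x hm
  rw [codimModel]
  omega

/-- The excess of the model `m`, relatively to a subspace `V` that contains it. -/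
noncomputable def excess (m : Finset ℝ) (V : Submodule ℝ (Vec n)) (e : Vec n) : ℝ :=
  max (‖V.starProjection e‖ ^ 2 -
    penaltyRoot x m * (‖e - V.starProjection e‖ ^ 2 / (codimModel x m - 1 : ℕ))) 0

/-- This is what the penalty is designed for: the mean excess is D_m + 1 times Dkhi evaluated at its
own root. -/
lemma lintegral_excess (hp : p + 9 ≤ n) {m : Finset ℝ} (hm : m ∈ models p)
    {V : Submodule ℝ (Vec n)} (hV : Module.finrank ℝ V = dimModel x m + 1) :
    ∫⁻ e, ENNReal.ofReal (excess x m V e) ∂(stdGaussian (Vec n)) =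
      ENNReal.ofReal ((dimModel x m + 1 : ℕ) * Real.exp (-weight m)) := by
  have hN := codimModel_ge x hp hm
  have hsub : n - (dimModel x m + 1) = codimModel x m - 1 := by rw [codimModel]; omega
  unfold excess
  rw [← ofReal_integral_eq_lintegral_ofReal
    (integrable_posPart_projections V hV hsub (penaltyRoot_nonneg x m))
    (Filter.Eventually.of_forall fun e => le_max_right _ _),
    integral_posPart_projections V (by omega) hV hsub, penaltyRoot,
    dkhi_eDkhi (by omega) (by omega) (weight_nonneg m)]

lemma tsum_lintegral_excess_le {C₀ : ℝ} (hC₀ : ∑' m : models p,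
      ENNReal.ofReal ((((m : Finset ℝ).card : ℝ) + 3) * Real.exp (-weight m)) ≤ ENNReal.ofReal C₀)
    (hp : p + 9 ≤ n) {V : models p → Submodule ℝ (Vec n)}
    (hV : ∀ m, Module.finrank ℝ (V m) = dimModel x m + 1) :
    ∑' m : models p, ∫⁻ e, ENNReal.ofReal (excess x m (V m) e) ∂(stdGaussian (Vec n)) ≤
      ENNReal.ofReal C₀ := by
  refine le_trans (ENNReal.tsum_le_tsum fun m => ?_) hC₀
  rw [lintegral_excess x hp m.2 (hV m)]
  refine ENNReal.ofReal_le_ofReal ?_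
  have h : dimModel x m + 1 ≤ (m : Finset ℝ).card + 3 :=
    Nat.succ_le_succ (dimModel_le x (models_subset_Ioo m.2))
  gcongr
  exact_mod_cast h

lemma measurable_excess (m : Finset ℝ) (V : Submodule ℝ (Vec n)) : Measurable (excess x m V) := by
  unfold excess
  fun_prop

lemma exists_superspaces (hp : p + 9 ≤ n) (μ : Vec n) :
    ∃ V : models p → Submodule ℝ (Vec n), ∀ m : models p, model x m ≤ V m ∧ μ ∈ V m ∧
      Module.finrank ℝ (V m) = dimModel x m + 1 := by
  have h (m : models p) := exists_submodule_finrank_succ (model x m) μ (by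
    have := dimModel_le_of_mem_models x m.2
    rw [dimModel] at this
    omega)
  choose V hV using h
  exact ⟨V, hV⟩

/-! ### Existence of a minimizer of the criterion -/

/-- A single squared coordinate exceeds a with positive probability, which bounds the tail below
uniformly in the degrees of freedom. -/
lemma exists_chiSq_tail_ge (a : ℝ) :
    ∃ δ : ℝ≥0∞, δ ≠ 0 ∧ ∀ d, 1 ≤ d → δ ≤ chiSq d (Set.Ici a) := by
  refine ⟨gaussianReal 0 1 {t | a ≤ t ^ 2}, fun h => ?_, fun d hd => ?_⟩
  · have h1 := gaussianReal_absolutelyContinuous' 0 one_ne_zero h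
    have h2 : volume (Set.Ici (max 1 a)) ≤ volume {t : ℝ | a ≤ t ^ 2} := by
      refine measure_mono fun t ht => ?_
      have ht1 : 1 ≤ t := (le_max_left _ _).trans ht
      have ht2 : a ≤ t := (le_max_right _ _).trans ht
      change a ≤ t ^ 2
      nlinarith
    rw [h1, Real.volume_Ici] at h2
    simp at h2
  · have hmeas : MeasurableSet {t : ℝ | a ≤ t ^ 2} := measurableSet_le (by fun_prop) (by fun_prop)
    rw [chiSq_eq_map_pi, Measure.map_apply (measurable_sumSq d) measurableSet_Ici,
      ← (measurePreserving_eval (fun _ : Fin d => gaussianReal 0 1)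
        (⟨0, hd⟩ : Fin d)).measure_preimage hmeas.nullMeasurableSet]
    refine measure_mono fun y hy => ?_
    exact le_trans hy (Finset.single_le_sum (f := fun i => y i ^ 2) (fun i _ => sq_nonneg _)
      (Finset.mem_univ _))

/-- If the penalized residual is at most s while the independent squared projection is at least s +
1, the excess is at least 1; Markov's inequality concludes. -/
lemma measure_penalized_residual_le (hp : p + 9 ≤ n) {m : Finset ℝ} (hm : m ∈ models p)
    {V : Submodule ℝ (Vec n)} (hV : Module.finrank ℝ V = dimModel x m + 1) (s : ℝ) {δ : ℝ≥0∞}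
    (hδ : ∀ d, 1 ≤ d → δ ≤ chiSq d (Set.Ici (s + 1))) :
    δ * stdGaussian (Vec n) {e | penaltyRoot x m *
      (‖e - V.starProjection e‖ ^ 2 / (codimModel x m - 1 : ℕ)) ≤ s} ≤
      ∫⁻ e, ENNReal.ofReal (excess x m V e) ∂(stdGaussian (Vec n)) := by
  have hN := codimModel_ge x hp hm
  have hsub : n - (dimModel x m + 1) = codimModel x m - 1 := by rw [codimModel]; omega
  let B : Set ℝ := {u | penaltyRoot x m * (u / (codimModel x m - 1 : ℕ)) ≤ s}
  have hB : MeasurableSet B := measurableSet_le (by fun_prop) (by fun_prop)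
  have hlaw := map_normSq_projections V hV
  rw [hsub] at hlaw
  have hBmeas : stdGaussian (Vec n) {e | penaltyRoot x m *
      (‖e - V.starProjection e‖ ^ 2 / (codimModel x m - 1 : ℕ)) ≤ s} =
      chiSq (codimModel x m - 1) B := by
    have h : chiSq (codimModel x m - 1) B =
        (chiSq (dimModel x m + 1)).prod (chiSq (codimModel x m - 1)) (Set.univ ×ˢ B) := by
      rw [Measure.prod_prod, measure_univ, one_mul]
    rw [h, ← hlaw, Measure.map_apply (by fun_prop) (MeasurableSet.univ.prod hB)]
    congr 1
    ext e
    simp [B]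
  have hrect : stdGaussian (Vec n) {e | s + 1 ≤ ‖V.starProjection e‖ ^ 2 ∧
      ‖e - V.starProjection e‖ ^ 2 ∈ B} =
      chiSq (dimModel x m + 1) (Set.Ici (s + 1)) * chiSq (codimModel x m - 1) B := by
    rw [← Measure.prod_prod, ← hlaw, Measure.map_apply (by fun_prop) (measurableSet_Ici.prod hB)]
    rfl
  have hmarkov := mul_meas_ge_le_lintegral (μ := stdGaussian (Vec n))
    (measurable_excess x m V).ennreal_ofReal 1
  rw [one_mul] at hmarkov
  calc _ ≤ chiSq (dimModel x m + 1) (Set.Ici (s + 1)) * chiSq (codimModel x m - 1) B := by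
        rw [hBmeas]
        gcongr
        exact hδ _ (by omega)
    _ = stdGaussian (Vec n) {e | s + 1 ≤ ‖V.starProjection e‖ ^ 2 ∧
          ‖e - V.starProjection e‖ ^ 2 ∈ B} := hrect.symm
    _ ≤ stdGaussian (Vec n) {e | 1 ≤ ENNReal.ofReal (excess x m V e)} := by
        refine measure_mono fun e he => ?_
        change 1 ≤ ENNReal.ofReal (excess x m V e)
        rw [ENNReal.one_le_ofReal, excess]
        refine le_max_of_le_left ?_
        have h1 : s + 1 ≤ ‖V.starProjection e‖ ^ 2 := he.1
        have h2 : penaltyRoot x m *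
          (‖e - V.starProjection e‖ ^ 2 / (codimModel x m - 1 : ℕ)) ≤ s := he.2
        linarith
    _ ≤ _ := hmarkov

/-- A criterion below c forces the penalized residual below c/(Kσ²). These events have summable
probabilities, so Borel–Cantelli applies. -/
lemma ae_finite_crit_le {K : ℝ} (hK : 1 < K) (hp : p + 9 ≤ n) (μ : Vec n) {σ : ℝ} (hσ : 0 < σ)
    (c : ℝ) : ∀ᵐ e ∂(stdGaussian (Vec n)),
      {m : models p | crit K x m (μ + σ • e) ≤ c}.Finite := by
  obtain ⟨V, hV⟩ := exists_superspaces (p := p) x hp μ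
  obtain ⟨C₀, -, hC₀⟩ := exists_tsum_exp_neg_weight_le
  set s := c / (K * σ ^ 2) with hs
  obtain ⟨δ, hδ0, hδ⟩ := exists_chiSq_tail_ge (s + 1)
  have hsum : ∑' m : models p, stdGaussian (Vec n) {e | penaltyRoot x m *
      (‖e - (V m).starProjection e‖ ^ 2 / (codimModel x m - 1 : ℕ)) ≤ s} ≠ ⊤ := by
    have h : δ * ∑' m : models p, stdGaussian (Vec n) {e | penaltyRoot x m *
        (‖e - (V m).starProjection e‖ ^ 2 / (codimModel x m - 1 : ℕ)) ≤ s} ≤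
        ENNReal.ofReal C₀ := by
      rw [← ENNReal.tsum_mul_left]
      exact (ENNReal.tsum_le_tsum fun m => measure_penalized_residual_le x hp m.2 (hV m).2.2 s
        hδ).trans (tsum_lintegral_excess_le x (hC₀ p) hp fun m => (hV m).2.2)
    intro htop
    rw [htop, ENNReal.mul_top hδ0] at h
    exact absurd h (by simp)
  filter_upwards [ae_finite_setOfPred_mem hsum] with e he
  refine he.subset fun m hm => ?_
  have hm' : crit K x m (μ + σ • e) ≤ c := hm
  have hN := codimModel_ge x hp m.2
  rw [crit_eq K x (by omega)] at hm'
  have hres := sq_norm_residual_ge (hV m).1 (hV m).2.1 σ e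
  set r := ‖μ + σ • e - (model x m).starProjection (μ + σ • e)‖ ^ 2
  have hroot := penaltyRoot_nonneg x m
  have hN0 : (0 : ℝ) ≤ (codimModel x m - 1 : ℕ) := Nat.cast_nonneg _
  have hr : 0 ≤ r := by positivity
  have ha : 0 ≤ K * (penaltyRoot x m / (codimModel x m - 1 : ℕ)) :=
    mul_nonneg (by linarith) (div_nonneg hroot hN0)
  change _ ≤ s
  rw [hs, le_div_iff₀ (by positivity)]
  have h := mul_le_mul_of_nonneg_right hres ha
  calc _ = σ ^ 2 * ‖e - (V m).starProjection e‖ ^ 2 *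
        (K * (penaltyRoot x m / (codimModel x m - 1 : ℕ))) := by ring
    _ ≤ c := by linarith

lemma ae_exists_minimizer {K : ℝ} (hK : 1 < K) (hp : p + 9 ≤ n) (μ : Vec n) {σ : ℝ}
    (hσ : 0 < σ) : ∀ᵐ e ∂(stdGaussian (Vec n)),
      ∃ m : models p, ∀ m' : models p, crit K x m (μ + σ • e) ≤ crit K x m' (μ + σ • e) := by
  -- The relevant level, the criterion of the empty model, is random; integer levels keep the
  -- exceptional set null.
  have h : ∀ᵐ e ∂(stdGaussian (Vec n)), ∀ k : ℕ,
      {m : models p | crit K x m (μ + σ • e) ≤ k}.Finite :=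
    ae_all_iff.2 fun k => ae_finite_crit_le x hK hp μ hσ k
  filter_upwards [h] with e he
  let m₀ : models p := ⟨∅, empty_mem_models p⟩
  obtain ⟨k, hk⟩ := exists_nat_ge (crit K x m₀ (μ + σ • e))
  obtain ⟨m, hm, hmin⟩ := Set.exists_min_image _ (fun m : models p => crit K x m (μ + σ • e))
    (he k) ⟨m₀, hk⟩
  refine ⟨m, fun m' => ?_⟩
  by_cases hm' : crit K x m' (μ + σ • e) ≤ k
  · exact hmin m' hm'
  · exact le_trans hm (not_le.1 hm').le

end Collection

/-- A countable family of measurable functions has a measurable selection of a minimizer. -/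
lemma exists_measurable_argmin {α ι : Type*} [MeasurableSpace α] [Countable ι] (i₀ : ι)
    {F : ι → α → ℝ} (hF : ∀ i, Measurable (F i)) :
    ∃ sel : α → ι, (∀ i, MeasurableSet (sel ⁻¹' {i})) ∧
      ∀ y, (∃ i, ∀ i', F i y ≤ F i' y) → ∀ i', F (sel y) y ≤ F i' y := by
  classical
  obtain ⟨f, hf⟩ := exists_injective_nat ι
  let M : ι → Set α := fun i => {y | ∀ i', F i y ≤ F i' y}
  have hM (i : ι) : MeasurableSet (M i) := by
    have : M i = ⋂ i', {y | F i y ≤ F i' y} := by ext; simp [M]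
    rw [this]
    exact MeasurableSet.iInter fun i' => measurableSet_le (hF i) (hF i')
  -- Ties are broken by the smallest code under `f`; `i₀` is the value where no minimizer exists.
  have hex (y : α) : ∃ i, (y ∈ M i ∧ ∀ j, f j < f i → y ∉ M j) ∨ ((∀ j, y ∉ M j) ∧ i = i₀) := by
    by_cases h : ∃ k, ∃ i, f i = k ∧ y ∈ M i
    · obtain ⟨i, hi, hiM⟩ := Nat.find_spec h
      exact ⟨i, Or.inl ⟨hiM, fun j hj hjM => Nat.find_min h (hi ▸ hj) ⟨j, rfl, hjM⟩⟩⟩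
    · push Not at h
      exact ⟨i₀, Or.inr ⟨fun j => h _ j rfl, rfl⟩⟩
  choose sel hsel using hex
  refine ⟨sel, fun i => ?_, ?_⟩
  · have : sel ⁻¹' {i} = (M i ∩ ⋂ j, {y | f j < f i → y ∉ M j}) ∪
        ((⋂ j, (M j)ᶜ) ∩ {_y | i = i₀}) := by
      ext y
      simp only [Set.mem_preimage, Set.mem_singleton_iff, Set.mem_union, Set.mem_inter_iff,
        Set.mem_iInter, Set.mem_ofPred_eq, Set.mem_compl_iff]
      constructor
      · rintro rfl
        exact hsel y
      · intro h
        rcases h with ⟨h1, h2⟩ | ⟨h1, rfl⟩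
        · rcases hsel y with ⟨h3, h4⟩ | ⟨h3, -⟩
          · refine hf (le_antisymm ?_ ?_)
            · exact not_lt.1 fun hlt => h4 i hlt h1
            · exact not_lt.1 fun hlt => h2 _ hlt h3
          · exact absurd h1 (h3 i)
        · rcases hsel y with ⟨h3, -⟩ | ⟨-, h4⟩
          · exact absurd h3 (h1 _)
          · exact h4
    rw [this]
    refine ((hM i).inter (MeasurableSet.iInter fun j => ?_)).union
      ((MeasurableSet.iInter fun j => (hM j).compl).inter (MeasurableSet.const _))
    by_cases h : f j < f i
    · simp only [h, forall_const]
      exact (hM j).compl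
    · simp [h]
  · rintro y ⟨i, hi⟩
    rcases hsel y with ⟨h, -⟩ | ⟨h, -⟩
    · exact h
    · exact absurd hi (h i)

lemma measurableEmbedding_affine {n : ℕ} (μ : Vec n) {σ : ℝ} (hσ : σ ≠ 0) :
    MeasurableEmbedding (fun e : Vec n => μ + σ • e) :=
  ((Homeomorph.smulOfNeZero σ hσ).trans (Homeomorph.addLeft μ)).measurableEmbedding

lemma exists_measurableSelection {n p : ℕ} (x : Fin n → UnitIco) {K : ℝ} (hK : 1 < K)
    (hp : p + 9 ≤ n) :
    ∃ sel : Vec n → models p, MeasurableSelection sel ∧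
      ∀ (μ : Vec n) (σ : ℝ), 0 < σ → MinimizesCrit K x μ σ sel := by
  obtain ⟨sel, hsel, hmin⟩ := exists_measurable_argmin
    (⟨∅, empty_mem_models p⟩ : models p) (F := fun m : models p => crit K x m)
    fun m => measurable_crit K x m
  refine ⟨sel, hsel, fun μ σ hσ => ?_⟩
  rw [MinimizesCrit, obsLaw, (measurableEmbedding_affine μ hσ.ne').ae_map_iff]
  filter_upwards [ae_exists_minimizer (p := p) x hK hp μ hσ] with e he m hm
  exact hmin _ he ⟨m, hm⟩

/-! ### The oracle inequality -/

section Oracle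

variable {n p : ℕ} (x : Fin n → UnitIco)

lemma measurable_lsEstimator (m : Finset ℝ) : Measurable (lsEstimator x m) := by
  unfold lsEstimator
  fun_prop

lemma measurable_selected_lsEstimator {sel : Vec n → models p} (hsel : MeasurableSelection sel) :
    Measurable fun y => lsEstimator x (sel y) y := by
  intro T hT
  have h : (fun y => lsEstimator x (sel y) y) ⁻¹' T =
      ⋃ m : models p, sel ⁻¹' {m} ∩ lsEstimator x m ⁻¹' T := by
    ext y
    simp
  rw [h]
  exact MeasurableSet.iUnion fun m => (hsel m).inter (measurable_lsEstimator x m hT)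

lemma norm_sub_lsEstimator_le (m : Finset ℝ) (μ : Vec n) (σ : ℝ) (e : Vec n) :
    ‖μ - lsEstimator x m (μ + σ • e)‖ ≤ ‖μ‖ + ‖σ • e‖ := by
  have h : μ - lsEstimator x m (μ + σ • e) =
      (μ - (model x m).starProjection μ) - (model x m).starProjection (σ • e) := by
    rw [lsEstimator, map_add]; abel
  rw [h]
  refine (norm_sub_le _ _).trans (add_le_add (norm_sub_starProjection_le_norm _ _) ?_)
  exact Submodule.norm_starProjection_apply_le _ _

lemma integrable_sq_loss {sel : Vec n → models p} (hsel : MeasurableSelection sel) (μ : Vec n)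
    (σ : ℝ) :
    Integrable (fun e => ‖μ - lsEstimator x (sel (μ + σ • e)) (μ + σ • e)‖ ^ 2)
      (stdGaussian (Vec n)) :=
  integrable_normSq_of_le
    (((measurable_selected_lsEstimator x hsel).comp (by fun_prop)).const_sub μ)
    fun e => norm_sub_lsEstimator_le x _ μ σ e

lemma integrable_loss_obsLaw {sel : Vec n → models p} (hsel : MeasurableSelection sel)
    (μ : Vec n) {σ : ℝ} (hσ : σ ≠ 0) :
    Integrable (fun y => ‖μ - lsEstimator x (sel y) y‖ ^ 2) (obsLaw μ σ) :=
  (measurableEmbedding_affine μ hσ).integrable_map_iff.2 (integrable_sq_loss x hsel μ σ)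

/-- Working with the positive part lets a countable sum of excesses serve as upper bound without
discussing its integrability. -/
lemma integral_le_of_le_lintegral {α : Type*} [MeasurableSpace α] {P : Measure α} {g : α → ℝ}
    (hg : Integrable g P) {c : ℝ} (hc : 0 ≤ c)
    (h : ∫⁻ a, ENNReal.ofReal (g a) ∂P ≤ ENNReal.ofReal c) : ∫ a, g a ∂P ≤ c := by
  rw [integral_eq_lintegral_pos_part_sub_lintegral_neg_part hg]
  have h1 := ENNReal.toReal_mono ENNReal.ofReal_ne_top h
  rw [ENNReal.toReal_ofReal hc] at h1
  linarith [(ENNReal.toReal_nonneg : 0 ≤ (∫⁻ a, ENNReal.ofReal (-g a) ∂P).toReal)]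

theorem oracle_inequality {C₀ : ℝ} (hC₀0 : 0 ≤ C₀) (hC₀ : ∑' m : models p,
      ENNReal.ofReal ((((m : Finset ℝ).card : ℝ) + 3) * Real.exp (-weight m)) ≤ ENNReal.ofReal C₀)
    (hp : p + 9 ≤ n) {K : ℝ} (hK : 1 < K) {μ : Vec n} {σ : ℝ} (hσ : 0 < σ)
    {sel : Vec n → models p} (hsel : MeasurableSelection sel) (hmin : MinimizesCrit K x μ σ sel)
    {m : Finset ℝ} (hm : m ∈ models p) :
    (1 - 1 / K) * ∫ y, ‖μ - lsEstimator x (sel y) y‖ ^ 2 ∂(obsLaw μ σ) ≤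
      ‖μ - (model x m).starProjection μ‖ ^ 2 *
        (1 + K * (penaltyRoot x m / (codimModel x m - 1 : ℕ))) +
      σ ^ 2 * (codimModel x m * (K * (penaltyRoot x m / (codimModel x m - 1 : ℕ)))) +
      K * σ ^ 2 * C₀ := by
  obtain ⟨V, hV⟩ := exists_superspaces (p := p) x hp μ
  have hN := codimModel_ge x hp hm
  set b := K * (penaltyRoot x m / (codimModel x m - 1 : ℕ))
  set loss : Vec n → ℝ := fun e => ‖μ - lsEstimator x (sel (μ + σ • e)) (μ + σ • e)‖ ^ 2
    with hloss
  -- By minimality `G` is at most Kσ² times the excess of the selected model, hence of the sum of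
  -- all excesses, which no longer depends on the selection.
  set G : Vec n → ℝ := fun e => (1 - 1 / K) * loss e + σ ^ 2 * ‖e‖ ^ 2 -
    ‖μ + σ • e - (model x m).starProjection (μ + σ • e)‖ ^ 2 * (1 + b) with hG
  have hi1 := (integrable_sq_loss x hsel μ σ).const_mul (1 - 1 / K)
  have hi2 := (integrable_normSq_stdGaussian n).const_mul (σ ^ 2)
  have hi3 := (integrable_sq_residual (model x m) μ σ).mul_const (1 + b)
  have hi12 : Integrable (fun e => (1 - 1 / K) * loss e + σ ^ 2 * ‖e‖ ^ 2)
    (stdGaussian (Vec n)) := hi1.add hi2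
  have hGint : Integrable G (stdGaussian (Vec n)) := hi12.sub hi3
  have hKσ : 0 ≤ K * σ ^ 2 := by positivity
  rw [MinimizesCrit, obsLaw, (measurableEmbedding_affine μ hσ.ne').ae_map_iff] at hmin
  have hGle : ∫⁻ e, ENNReal.ofReal (G e) ∂(stdGaussian (Vec n)) ≤
      ENNReal.ofReal (K * σ ^ 2 * C₀) := by
    calc ∫⁻ e, ENNReal.ofReal (G e) ∂(stdGaussian (Vec n))
        ≤ ∫⁻ e, ENNReal.ofReal (K * σ ^ 2) *
            ∑' m : models p, ENNReal.ofReal (excess x m (V m) e) ∂(stdGaussian (Vec n)) := by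
          refine lintegral_mono_ae ?_
          filter_upwards [hmin] with e he
          set s := sel (μ + σ • e)
          have hNs := codimModel_ge x hp s.2
          have h1 := he m hm
          rw [crit_eq K x (by omega), crit_eq K x (by omega)] at h1
          have h2 := loss_le_penalized_residual (hV s).1 (hV s).2.1 hσ hK
            (a := penaltyRoot x s / (codimModel x s - 1 : ℕ))
            (div_nonneg (penaltyRoot_nonneg x s) (Nat.cast_nonneg _)) e
          have h3 : G e ≤ K * σ ^ 2 * excess x s (V s) e := by
            rw [excess, ← mul_div_assoc, mul_div_right_comm, hG, hloss]
            simp only [lsEstimator]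
            linarith
          calc ENNReal.ofReal (G e) ≤ ENNReal.ofReal (K * σ ^ 2 * excess x s (V s) e) :=
                ENNReal.ofReal_le_ofReal h3
            _ = ENNReal.ofReal (K * σ ^ 2) * ENNReal.ofReal (excess x s (V s) e) :=
                ENNReal.ofReal_mul hKσ
            _ ≤ _ := by
                gcongr
                exact ENNReal.le_tsum (f := fun m : models p =>
                  ENNReal.ofReal (excess x m (V m) e)) s
      _ = ENNReal.ofReal (K * σ ^ 2) * ∑' m : models p,
            ∫⁻ e, ENNReal.ofReal (excess x m (V m) e) ∂(stdGaussian (Vec n)) := by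
          rw [lintegral_const_mul' _ _ ENNReal.ofReal_ne_top, lintegral_tsum]
          exact fun m => (measurable_excess x m (V m)).ennreal_ofReal.aemeasurable
      _ ≤ ENNReal.ofReal (K * σ ^ 2) * ENNReal.ofReal C₀ := by
          gcongr
          exact tsum_lintegral_excess_le x hC₀ hp fun m => (hV m).2.2
      _ = _ := (ENNReal.ofReal_mul hKσ).symm
  have hfin := integral_le_of_le_lintegral hGint (mul_nonneg hKσ hC₀0) hGle
  rw [hG, integral_sub hi12 hi3, integral_add hi1 hi2, integral_const_mul, integral_const_mul,
    integral_mul_const, integral_normSq_stdGaussian, integral_sq_residual] at hfin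
  rw [obsLaw, (measurableEmbedding_affine μ hσ.ne').integral_map]
  change _ - (_ + σ ^ 2 * (codimModel x m : ℝ)) * (1 + b) ≤ _ at hfin
  -- The mean of σ²‖ε‖² offsets the pure noise part of the residual of `m`.
  have hNn : σ ^ 2 * (codimModel x m : ℝ) ≤ σ ^ 2 * n := by
    gcongr
    exact Nat.sub_le _ _
  linarith

end Oracle

/-! ### Risk over the continuous piecewise linear functions -/

lemma exp_sub_one_le {u B : ℝ} (hu : 0 ≤ u) (huB : u ≤ B) :
    Real.exp u - 1 ≤ u * Real.exp B := by
  have h1 : 1 - u ≤ Real.exp (-u) := by linarith [Real.add_one_le_exp (-u)]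
  have h2 : (1 - u) * Real.exp u ≤ Real.exp (-u) * Real.exp u := by gcongr
  rw [← Real.exp_add, neg_add_cancel, Real.exp_zero] at h2
  have h3 : u * Real.exp u ≤ u * Real.exp B := by gcongr
  linarith

/-- Since n/q ≤ exp(n/q), the bound on R makes the ratio at most exp((1 + 2κ')n/q). This keeps the
weight of the approximating model of order n. -/
lemma mul_log_signal_ratio_le {n q : ℕ} (hq : 1 ≤ q) (hn : 1 ≤ n) {σ R κ' : ℝ} (hσ : 0 < σ) (hR : 0 < R)
    (hκ' : 0 < κ') (hRσ : R ≤ σ * Real.exp (κ' * n / q)) :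
    q * Real.log (max 1 (n * R ^ 2 / (q * σ ^ 2))) ≤ (1 + 2 * κ') * n := by
  have hq0 : (0 : ℝ) < q := by exact_mod_cast hq
  have hn0 : (0 : ℝ) < n := by exact_mod_cast hn
  have hmax : max 1 (n * R ^ 2 / (q * σ ^ 2)) ≤ Real.exp ((1 + 2 * κ') * n / q) := by
    refine max_le (Real.one_le_exp (by positivity)) ?_
    have h1 : (n : ℝ) / q ≤ Real.exp (n / q) := by linarith [Real.add_one_le_exp ((n : ℝ) / q)]
    have h2 : R / σ ≤ Real.exp (κ' * n / q) := by rwa [div_le_iff₀' hσ]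
    calc n * R ^ 2 / (q * σ ^ 2) = n / q * (R / σ) ^ 2 := by field_simp
      _ ≤ Real.exp (n / q) * Real.exp (κ' * n / q) ^ 2 := by gcongr
      _ = Real.exp ((1 + 2 * κ') * n / q) := by
          rw [← Real.exp_nat_mul, ← Real.exp_add]
          congr 1
          push_cast
          ring
  have hlog := Real.log_le_log (by positivity) hmax
  rw [Real.log_exp, le_div_iff₀ hq0] at hlog
  linarith

lemma sq_bias_le {n : ℕ} (x : Fin n → UnitIco) {m : Finset ℝ} {f g : UnitIco → ℝ}
    (hg : g ∈ splines m) {d : ℝ} (hd : ∀ t, |f t - g t| ≤ d) {μ : Vec n}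
    (hμ : ∀ i, μ i = f (x i)) :
    ‖μ - (model x m).starProjection μ‖ ^ 2 ≤ n * d ^ 2 := by
  have h := norm_sub_starProjection_le (model x m) μ (v := evalMap x g)
    (Submodule.mem_map_of_mem hg)
  calc ‖μ - (model x m).starProjection μ‖ ^ 2 ≤ ‖μ - evalMap x g‖ ^ 2 := by gcongr
    _ = ∑ i, (f (x i) - g (x i)) ^ 2 := by
        rw [EuclideanSpace.real_norm_sq_eq]
        refine Finset.sum_congr rfl fun i _ => ?_
        rw [← hμ i]
        rfl
    _ ≤ ∑ _i : Fin n, d ^ 2 := Finset.sum_le_sum fun i _ => by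
        rw [← sq_abs]
        have := hd (x i)
        gcongr
    _ = n * d ^ 2 := by simp

/-- In the Chernoff bound the exponent u satisfies u(N - 1) ≤ 2(7 + 8)Λ = 30Λ and, as N ≤ 2(N - 1),
u ≤ B. Hence exp u - 1 ≤ u exp B makes the penalty linear in Λ. -/
lemma penaltyRoot_div_le {n p : ℕ} (x : Fin n → UnitIco) (hp : p + 9 ≤ n) {m : Finset ℝ}
    (hm : m ∈ models p) {Λ ν B : ℝ} (hw : weight m ≤ 7 * Λ) (hD : (dimModel x m : ℝ) + 1 ≤ 4 * Λ)
    (hν : 0 < ν) (hcodim : ν ≤ codimModel x m) (hB : 60 * Λ / ν ≤ B) :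
    penaltyRoot x m / (codimModel x m - 1 : ℕ) ≤ 2 * B * Real.exp B ∧
      codimModel x m * (penaltyRoot x m / (codimModel x m - 1 : ℕ)) ≤ 120 * Λ * Real.exp B := by
  have hN := codimModel_ge x hp hm
  set D := dimModel x m with hDdef
  set N := codimModel x m with hNdef
  set u : ℝ := 2 * (weight m + 2 * (D + 1 : ℕ)) / (N - 1 : ℕ) with hu
  have hN1 : ((N - 1 : ℕ) : ℝ) = N - 1 := by rw [Nat.cast_sub (by omega)]; simp
  have hN7 : (7 : ℝ) ≤ N := by exact_mod_cast hN
  have hw0 := weight_nonneg m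
  have hN0 : (0 : ℝ) < (N - 1 : ℕ) := by rw [hN1]; linarith
  have hu0 : 0 ≤ u := by positivity
  have hΛ : 0 ≤ Λ := by linarith
  have huN : u * (N - 1 : ℕ) ≤ 30 * Λ := by
    rw [hu, div_mul_cancel₀ _ hN0.ne']
    push_cast
    linarith
  have huB : u ≤ B := by
    refine le_trans ?_ hB
    rw [le_div_iff₀ hν]
    have h1 : ν ≤ 2 * (N - 1 : ℕ) := by rw [hN1]; linarith
    calc u * ν ≤ u * (2 * (N - 1 : ℕ)) := by gcongr
      _ ≤ 60 * Λ := by linarith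
  have hroot : penaltyRoot x m / (N - 1 : ℕ) ≤ 2 * (u * Real.exp B) := by
    rw [div_le_iff₀ hN0]
    calc penaltyRoot x m ≤ eDkhiBound (D + 1) (N - 1) (weight m) :=
          eDkhi_le (by omega) (by omega) hw0
      _ = 2 * (Real.exp u - 1) * (N - 1 : ℕ) := by rw [eDkhiBound, hu]; ring
      _ ≤ _ := by
          gcongr
          exact exp_sub_one_le hu0 huB
  constructor
  · calc _ ≤ _ := hroot
      _ ≤ 2 * (B * Real.exp B) := by gcongr
      _ = _ := by ring
  · calc N * (penaltyRoot x m / (N - 1 : ℕ)) ≤ (2 * (N - 1 : ℕ)) * (2 * (u * Real.exp B)) := by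
          gcongr
          · exact div_nonneg (penaltyRoot_nonneg x m) hN0.le
          · rw [hN1]; linarith
      _ = 4 * (u * (N - 1 : ℕ)) * Real.exp B := by ring
      _ ≤ 4 * (30 * Λ) * Real.exp B := by gcongr
      _ = _ := by ring

/-- For a suitable dyadic level, a continuous piecewise linear function is well approximated by a
spline whose knots form a model of small weight. -/
lemma exists_model_approx {n p q : ℕ} (x : Fin n → UnitIco) (hn : 1 ≤ n) (hq : 1 ≤ q)
    (hqp : q ≤ p) {σ R : ℝ} (hσ : 0 < σ) (hR : 0 < R) {f : UnitIco → ℝ}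
    (hf : f ∈ contPiecewiseLinear q R) {μ : Vec n} (hμ : ∀ i, μ i = f (x i)) {Λ : ℝ}
    (hΛ : Λ = q * (1 + 1 / 2 * Real.log (max 1 (n * R ^ 2 / (q * σ ^ 2))))) :
    ∃ m ∈ models p, weight m ≤ 7 * Λ ∧ m.card ≤ q ∧
      ‖μ - (model x m).starProjection μ‖ ^ 2 ≤ q * σ ^ 2 := by
  have hq0 : (0 : ℝ) < q := by exact_mod_cast hq
  have hn0 : (0 : ℝ) < n := by exact_mod_cast hn
  set ρ := n * R ^ 2 / (q * σ ^ 2) with hρ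
  -- With 2^j ≥ qs the squared bias is at most nR²/s², so s² ≥ ρ is just what brings it down to qσ².
  set s := √(max 1 ρ) with hs
  have hs1 : 1 ≤ s := Real.one_le_sqrt.2 (le_max_left _ _)
  have hs2 : ρ ≤ s ^ 2 := by
    rw [hs, Real.sq_sqrt (by positivity)]
    exact le_max_right _ _
  have hlogs : Real.log s = 1 / 2 * Real.log (max 1 ρ) := by
    rw [hs, Real.log_sqrt (by positivity)]
    ring
  obtain ⟨j, hj, hqs, hlev⟩ := exists_level hq hs1
  obtain ⟨m, hmj, hmq, g, hg, hfg⟩ := exists_dyadic_spline_approx hq hf j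
  refine ⟨m, mem_models hj hmj (hmq.trans hqp), ?_, hmq, ?_⟩
  · rw [hΛ, ← hlogs]
    exact (weight_le hj hmj).trans
      (hlev _ hmq (card_dyadicGrid j ▸ Finset.card_le_card hmj))
  · have hR2 : n * R ^ 2 ≤ q * σ ^ 2 * s ^ 2 := by
      rw [hρ, div_le_iff₀ (by positivity)] at hs2
      linarith
    calc _ ≤ n * (q * R / 2 ^ j) ^ 2 := sq_bias_le x hg hfg hμ
      _ ≤ n * (q * R / (q * s)) ^ 2 := by gcongr
      _ = n * R ^ 2 / s ^ 2 := by field_simp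
      _ ≤ q * σ ^ 2 := by
          rw [div_le_iff₀ (by positivity)]
          exact hR2

end ChangePoint

/-! ### The risk bound. -/

theorem corollary2 (K κ κ' : ℝ) (hK : 1 < K) (hκ₀ : 0 < κ) (hκ₁ : κ < 1) (hκ' : 0 < κ') :
    ∃ C : ℝ, 0 < C ∧
      ∀ n p : ℕ, 9 ≤ n → (p : ℝ) ≤ min (κ * n - 2) ((n : ℝ) - 9) →
      ∀ x : Fin n → ChangePoint.UnitIco,
        (∃ sel : ChangePoint.Vec n → ChangePoint.models p,
          ChangePoint.MeasurableSelection sel ∧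
          ∀ (μ : ChangePoint.Vec n) (σ : ℝ), 0 < σ → ChangePoint.MinimizesCrit K x μ σ sel) ∧
        ∀ q : ℕ, 1 ≤ q → q ≤ p →
        ∀ σ R : ℝ, 0 < σ → 0 < R → R ≤ σ * Real.exp (κ' * n / q) →
        ∀ f ∈ ChangePoint.contPiecewiseLinear q R,
        ∀ μ : ChangePoint.Vec n, (∀ i, μ i = f (x i)) →
        ∀ sel : ChangePoint.Vec n → ChangePoint.models p,
          ChangePoint.MeasurableSelection sel →
          ChangePoint.MinimizesCrit K x μ σ sel →
          MeasureTheory.Integrable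
            (fun y => ‖μ - ChangePoint.lsEstimator x (sel y) y‖ ^ 2) (ChangePoint.obsLaw μ σ) ∧
          ∫ y, ‖μ - ChangePoint.lsEstimator x (sel y) y‖ ^ 2 ∂(ChangePoint.obsLaw μ σ) ≤
            C * q * σ ^ 2 * (1 + Real.log (max 1 (n * R ^ 2 / (q * σ ^ 2)))) := by
  obtain ⟨C₀, hC₀0, hC₀⟩ := ChangePoint.exists_tsum_exp_neg_weight_le
  -- This bounds 60Λ/((1 - κ)n), because Λ ≤ (2 + κ')n, while (1 - κ)n ≤ N_m.
  set B := 60 * (2 + κ') / (1 - κ) with hB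
  have hκ2 : 0 < 1 - κ := by linarith
  have hB0 : 0 ≤ B := by positivity
  -- The terms pay, in order, for the bias, the bias inflated by the penalty, the penalty on the
  -- noise, and the total excess.
  set C₁ := 1 + K * (2 * B * Real.exp B) + K * (120 * Real.exp B) + K * C₀ with hC₁
  have hC₁0 : 0 < C₁ := by positivity
  have hK1 : 0 < 1 - 1 / K := by
    rw [sub_pos, div_lt_one (by linarith)]
    exact hK
  refine ⟨C₁ / (1 - 1 / K), by positivity, fun n p hn hp x => ?_⟩
  have hpn : p + 9 ≤ n := by
    have h : (p : ℝ) ≤ n - 9 := hp.trans (min_le_right _ _)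
    have h' : ((p + 9 : ℕ) : ℝ) ≤ n := by push_cast; linarith
    exact_mod_cast h'
  have hpκ : (p : ℝ) ≤ κ * n - 2 := hp.trans (min_le_left _ _)
  refine ⟨ChangePoint.exists_measurableSelection x hK hpn, ?_⟩
  intro q hq hqp σ R hσ hR hRσ f hf μ hμ sel hsel hmin
  refine ⟨ChangePoint.integrable_loss_obsLaw x hsel μ hσ.ne', ?_⟩
  have hn0 : (0 : ℝ) < n := by
    have : 0 < n := by omega
    exact_mod_cast this
  have hq1 : (1 : ℝ) ≤ q := by exact_mod_cast hq
  have hqn : (q : ℝ) ≤ n := by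
    have : q ≤ n := by omega
    exact_mod_cast this
  have hqlog := ChangePoint.mul_log_signal_ratio_le hq (by omega : 1 ≤ n) hσ hR hκ' hRσ
  set ℓ := Real.log (max 1 (n * R ^ 2 / (q * σ ^ 2))) with hℓ
  have hℓ0 : 0 ≤ ℓ := Real.log_nonneg (le_max_left _ _)
  set Λ := q * (1 + 1 / 2 * ℓ) with hΛ
  have hΛq : q ≤ Λ := le_mul_of_one_le_right (by linarith) (by linarith)
  obtain ⟨m, hm, hw, hmq, hbias⟩ := ChangePoint.exists_model_approx x (by omega : 1 ≤ n) hq hqp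
    hσ hR hf hμ hΛ
  have hdim : (ChangePoint.dimModel x m : ℝ) + 1 ≤ 4 * Λ := by
    have h : ChangePoint.dimModel x m ≤ q + 2 :=
      (ChangePoint.dimModel_le x (ChangePoint.models_subset_Ioo hm)).trans (by omega)
    have h' : (ChangePoint.dimModel x m : ℝ) ≤ q + 2 := by exact_mod_cast h
    linarith
  -- The -2 in p ≤ κn - 2 compensates the +2 in D_m ≤ p + 2.
  have hcodim : (1 - κ) * n ≤ ChangePoint.codimModel x m := by
    have h := ChangePoint.dimModel_le_of_mem_models x hm
    have h' : n ≤ ChangePoint.codimModel x m + (p + 2) := by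
      rw [ChangePoint.codimModel]; omega
    have h2 : (n : ℝ) ≤ ChangePoint.codimModel x m + (p + 2) := by exact_mod_cast h'
    linarith
  have hΛn : Λ ≤ (2 + κ') * n := by
    have h : Λ = q + 1 / 2 * (q * ℓ) := by rw [hΛ]; ring
    rw [h]
    linarith
  have hΛB : 60 * Λ / ((1 - κ) * n) ≤ B := by
    rw [hB, div_le_div_iff₀ (by positivity) hκ2]
    calc 60 * Λ * (1 - κ) ≤ 60 * ((2 + κ') * n) * (1 - κ) := by gcongr
      _ = _ := by ring
  obtain ⟨hpen1, hpen2⟩ := ChangePoint.penaltyRoot_div_le x hpn hm hw hdim (by positivity)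
    hcodim hΛB
  have horacle := ChangePoint.oracle_inequality x hC₀0 (hC₀ p) hpn hK hσ hsel hmin hm
  set b := ChangePoint.penaltyRoot x m / (ChangePoint.codimModel x m - 1 : ℕ) with hb
  have hb0 : 0 ≤ b := div_nonneg (ChangePoint.penaltyRoot_nonneg x m) (Nat.cast_nonneg _)
  have hK0 : 0 ≤ K := by linarith
  have hmain : (1 - 1 / K) *
      ∫ y, ‖μ - ChangePoint.lsEstimator x (sel y) y‖ ^ 2 ∂(ChangePoint.obsLaw μ σ) ≤
      C₁ * (σ ^ 2 * Λ) := by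
    have h1 : ‖μ - (ChangePoint.model x m).starProjection μ‖ ^ 2 * (1 + K * b) ≤
        (σ ^ 2 * Λ) * (1 + K * (2 * B * Real.exp B)) := by
      have : ‖μ - (ChangePoint.model x m).starProjection μ‖ ^ 2 ≤ σ ^ 2 * Λ :=
        hbias.trans (by rw [mul_comm]; gcongr)
      gcongr
    have h2 : σ ^ 2 * (ChangePoint.codimModel x m * (K * b)) ≤
        σ ^ 2 * (K * (120 * Λ * Real.exp B)) := by
      rw [mul_left_comm (ChangePoint.codimModel x m : ℝ)]
      gcongr
    have h3 : K * σ ^ 2 * C₀ ≤ K * σ ^ 2 * C₀ * Λ :=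
      le_mul_of_one_le_right (by positivity) (hq1.trans hΛq)
    calc _ ≤ _ := horacle
      _ ≤ (σ ^ 2 * Λ) * (1 + K * (2 * B * Real.exp B)) + σ ^ 2 * (K * (120 * Λ * Real.exp B)) +
          K * σ ^ 2 * C₀ * Λ := by gcongr
      _ = C₁ * (σ ^ 2 * Λ) := by rw [hC₁]; ring
  rw [mul_comm (1 - 1 / K), ← le_div_iff₀ hK1] at hmain
  have hΛℓ : Λ ≤ q * (1 + ℓ) := by
    rw [hΛ]
    gcongr
    linarith
  calc _ ≤ _ := hmain
    _ ≤ C₁ * (σ ^ 2 * (q * (1 + ℓ))) / (1 - 1 / K) := by gcongr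
    _ = _ := by ring
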